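/- For $d,n\in\mathbb N$ and a matrix $\beta\in\{-1,1\}^{n\times d}$ with rows $\beta_1,\dots,\beta_n$, let $B=B(\beta)\in\mathbb R^{n\times\binom d2}$ be the matrix, with columns indexed by the pairs $1\le j_1<j_2\le d$, whose $i$-th row is $\beta_i^{(2)}=(\beta_{i,j_1}\beta_{i,j_2})_{j_1<j_2}$. The rows $\beta_i$ are called independent Rademacher vectors if all entries $\beta_{i,j}$ are independent and equal to $\pm1$ with probability $1/2$ each. A vector is $k$-sparse if it has at most $k$ nonzero entries, and $a_k$ denotes a best $k$-term approximation of $a$, i.e. a $k$-sparse vector minimizing $\|a-z\|_1$ over all $k$-sparse $z$. A matrix $B$ with $n$ rows satisfies the $\ell_2/\ell_1$ RIP of order $k$ with constants $\gamma^{\mathrm{lb}}_k\in(0,1)$ and $\gamma^{\mathrm{ub}}_k>0$ if $(1-\gamma^{\mathrm{lb}}_k)\|x\|_2\le\frac1n\|Bx\|_1\le(1+\gamma^{\mathrm{ub}}_k)\|x\|_2$ for all $k$-sparse $x$. Given $y=Ba+\eta$ with $a\in\mathbb R^{\binom d2}$ and $\|\eta\|_1\le\nu$, let $\hat a$ be any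 solution of $$\text{(P2)}\qquad \min_{z}\ \|z\|_1\quad\text{subject to}\quad\|y-Bz\|_1\le\nu .$$ 1. There exist absolute constants $c_1,c_2,c_3>0$ such that, for all $d,n$ and every fixed $a\in\mathbb R^{\binom d2}$, if the rows $\beta_1,\dots,\beta_n$ are independent Rademacher vectors, then $$c_1\|a\|_2\le\tfrac1n\|Ba\|_1\le c_2\|a\|_2$$ holds with probability at least $1-\exp(-c_3n)$. 2. With the constants $c_1,c_2$ from part 1, there exist absolute constants $c_1',c_2',c_3'>0$ such that if $1\le k\le\binom d2$ and $n>c_3'\,k\log(d^2/k)$, then there are constants $\gamma^{\mathrm{lb}}_k,\gamma^{\mathrm{ub}}_k$ with $1-\gamma^{\mathrm{lb}}_k\ge c_1/2$ and $1+\gamma^{\mathrm{ub}}_k\le2c_2$ such that, if the rows $\beta_i$ are independent Rademacher vectors, $B$ satisfies the $\ell_2/\ell_1$ RIP of order $k$ with constants $\gamma^{\mathrm{lb}}_k,\gamma^{\mathrm{ub}}_k$ with probability at least $1-c_1'\exp(-c_2'n)$. 3. There exist universal constants $\tilde C_1,\tilde C_2,\tilde C_3>0$ such that the following holds for every realization $\beta\in\{-1,1\}^{n\times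 d}$ and $B=B(\beta)$. If $k,K$ are nonnegative integers with $K>2k$ and $B$ satisfies the $\ell_2/\ell_1$ RIP of orders $k+K$ and $K$ with $$\frac{1-\gamma^{\mathrm{lb}}_{k+K}}{\sqrt2}-(1+\gamma^{\mathrm{ub}}_K)\sqrt{\frac kK}\ \ge\ b>0$$ for some $b>0$, then, for all $a$, $\eta$, $\nu$ with $\|\eta\|_1\le\nu$, every solution $\hat a$ of (P2) satisfies $$\|\hat a-a\|_2\le\Bigl(\frac{\tilde C_1}{b}+\tilde C_3\Bigr)\frac{\|a-a_k\|_1}{\sqrt K}+\frac{\tilde C_2}{b}\,\frac{\nu}{n}.$$ 4. There exist absolute constants $\tilde c_3,\tilde c_4,C_3,C_4>0$ such that if $1\le k\le\binom d2$, $n\ge\tilde c_3\,k\log(d^2/k)$ and the rows $\beta_i$ are independent Rademacher vectors, then with probability at least $1-\exp(-\tilde c_4n)$, simultaneously for all $a\in\mathbb R^{\binom d2}$ and all $\eta,\nu$ with $\|\eta\|_1\le\nu$, every solution $\hat a$ of (P2) satisfies $$\|\hat a-a\|_2\le C_3\frac{\|a-a_k\|_1}{\sqrt k}+C_4\frac{\nu}{n}.$$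 -/

import Mathlib

open MeasureTheory ProbabilityTheory

universe u

noncomputable section

namespace SparseBilinear

/-- The `ℓ1` norm of a real vector. -/
def l1Norm {ι : Type*} [Fintype ι] (x : ι → ℝ) : ℝ :=
  ‖(WithLp.toLp 1 x : PiLp 1 (fun _ : ι => ℝ))‖

/-- The `ℓ2` norm of a real vector. -/
def l2Norm {ι : Type*} [Fintype ι] (x : ι → ℝ) : ℝ :=
  ‖(WithLp.toLp 2 x : EuclideanSpace ℝ ι)‖

theorem l1Norm_eq {ι : Type*} [Fintype ι] (x : ι → ℝ) : l1Norm x = ∑ i, |x i| := by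
  simp [l1Norm, PiLp.norm_eq_of_L1]

theorem l2Norm_eq {ι : Type*} [Fintype ι] (x : ι → ℝ) :
    l2Norm x = Real.sqrt (∑ i, x i ^ 2) := by
  simp [l2Norm, EuclideanSpace.norm_eq]

/-- `x` has at most `k` nonzero entries. -/
def IsSparse {ι : Type*} (k : ℕ) (x : ι → ℝ) : Prop :=
  {i | x i ≠ 0}.ncard ≤ k

/-- `z` is a best `k`-term approximation of `a`: among all `k`-sparse vectors it has the
smallest `ℓ1` distance to `a`. -/
def IsBestTermApprox {ι : Type*} [Fintype ι] (k : ℕ) (a z : ι → ℝ) : Prop :=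
  IsSparse k z ∧ ∀ w : ι → ℝ, IsSparse k w → l1Norm (a - z) ≤ l1Norm (a - w)

/-- The `ℓ2/ℓ1` restricted isometry property of order `k` with constants
`γlb ∈ (0,1)` and `γub > 0`. -/
def SatisfiesRIP {n : ℕ} {ι : Type*} [Fintype ι] (B : Matrix (Fin n) ι ℝ) (k : ℕ)
    (γlb γub : ℝ) : Prop :=
  0 < γlb ∧ γlb < 1 ∧ 0 < γub ∧
    ∀ x : ι → ℝ, IsSparse k x →
      (1 - γlb) * l2Norm x ≤ 1 / (n : ℝ) * l1Norm (B.mulVec x) ∧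
      1 / (n : ℝ) * l1Norm (B.mulVec x) ≤ (1 + γub) * l2Norm x

/-- The index set of pairs `(j₁, j₂)` with `1 ≤ j₁ < j₂ ≤ d`, which has `d choose 2` elements. -/
abbrev Pairs (d : ℕ) : Type := {p : Fin d × Fin d // p.1 < p.2}

/-- The matrix whose `i`-th row is `β_i^{(2)}`, where `β_i` is the `i`-th row of `β` and
`β^{(2)}_{(j₁, j₂)} = β_{j₁} β_{j₂}`. -/
def bilinMatrix {n d : ℕ} (β : Fin n → Fin d → ℝ) : Matrix (Fin n) (Pairs d) ℝ :=
  Matrix.of fun i p => β i p.1.1 * β i p.1.2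

/-- `z` solves: minimize `‖z‖₁` subject to `‖y - B z‖₁ ≤ ν`. -/
def IsSolutionP2 {n : ℕ} {ι : Type*} [Fintype ι] (B : Matrix (Fin n) ι ℝ) (y : Fin n → ℝ)
    (ν : ℝ) (z : ι → ℝ) : Prop :=
  l1Norm (y - B.mulVec z) ≤ ν ∧
    ∀ w : ι → ℝ, l1Norm (y - B.mulVec w) ≤ ν → l1Norm z ≤ l1Norm w

/-- `β₁, …, β_n` are independent Rademacher vectors in `{-1,1}^d`: all entries are
independent and each equals `1` or `-1` with probability `1/2`. -/
structure IsRademacherMatrix {Ω : Type*} [MeasurableSpace Ω] (P : Measure Ω) {n d : ℕ}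
    (β : Fin n → Fin d → Ω → ℝ) : Prop where
  measurable : ∀ i j, Measurable (β i j)
  prob_one : ∀ i j, P.real {ω | β i j ω = 1} = 1 / 2
  prob_neg_one : ∀ i j, P.real {ω | β i j ω = -1} = 1 / 2
  indep : iIndepFun (fun (q : Fin n × Fin d) => β q.1 q.2) P

end SparseBilinear

end

namespace SparseBilinear

/-! A Rademacher matrix is uniform over finitely many sign patterns, so every probability is bounded
by counting bad patterns.

For fixed `a`, each entry of `B a` is a Rademacher chaos of order two. Hypercontractivity, by
induction on the coordinates, bounds its moment of order `2m` by `((2m)² ‖a‖₂²)^m`. The second and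
fourth moments keep the mean of its absolute value away from zero, and the growth of the moments
makes an exponential moment finite. Chernoff's bound in both directions then gives concentration of
`‖B a‖₁ / n` (`card_not_concentrated`).

The restricted isometry property follows by a union bound over a net. The net consists of integer
vectors of `ℓ1` norm at most `R k`; by homogeneity only their directions matter, and a generating
function counts them. A sparse vector differs from a multiple of a net point by a small vector that
is again sparse, so the bounds pass to all sparse vectors (`meanAbs_bounds_of_intNet`).

Recovery uses Maurey's empirical method rather than a sorted block decomposition. The part of the
error off a `k`-set is a mean of `K`-sparse vectors. As the entries of `B` are at most 1 in modulus,
replacing that part by a sample costs on average at most its `ℓ1` norm over `√K`. Hence the lower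
isometry bound alone, with the cone condition from `ℓ1` minimality, controls the error. -/

/-! ### Moments of Rademacher sums and of chaoses of order two -/

theorem sum_range_even_odd (f : ℕ → ℝ) (m : ℕ) :
    ∑ i ∈ Finset.range (2 * m + 1), f i =
      ∑ j ∈ Finset.range (m + 1), f (2 * j) + ∑ j ∈ Finset.range m, f (2 * j + 1) := by
  induction m with
  | zero => simp
  | succ m ih =>
    rw [show 2 * (m + 1) + 1 = 2 * m + 1 + 1 + 1 by ring, Finset.sum_range_succ,
      Finset.sum_range_succ, ih, Finset.sum_range_succ _ (m + 1), Finset.sum_range_succ _ m,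
      Finset.sum_range_succ (fun j => f (2 * j + 1)) m]
    rw [show 2 * m + 1 + 1 = 2 * (m + 1) by ring]
    ring

/-- Passing from `j` to `j + 1`, the left side grows by a factor `(2m - 2j - 1) / (2j + 1)` more
than `m.choose j` does, and this factor is at most `2m`. It is the termwise comparison behind
`two_point`. -/
theorem choose_two_mul_le (m j : ℕ) :
    ((2 * m).choose (2 * j) : ℝ) ≤ (2 * m) ^ j * (m.choose j : ℝ) := by
  have key : (2 * m).choose (2 * j) ≤ (2 * m) ^ j * m.choose j := by
    induction j with
    | zero => simp
    | succ j ih =>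
      rcases Nat.lt_or_ge m (j + 1) with h | h
      · rw [Nat.choose_eq_zero_of_lt (by omega : 2 * m < 2 * (j + 1))]
        exact Nat.zero_le _
      obtain ⟨r, rfl⟩ := Nat.exists_eq_add_of_le h
      have e1 := Nat.choose_succ_right_eq (2 * (j + 1 + r)) (2 * j)
      have e2 := Nat.choose_succ_right_eq (2 * (j + 1 + r)) (2 * j + 1)
      have e3 := Nat.choose_succ_right_eq (j + 1 + r) j
      rw [show 2 * (j + 1 + r) - 2 * j = 2 * (r + 1) by omega] at e1
      rw [show 2 * (j + 1 + r) - (2 * j + 1) = 2 * r + 1 by omega] at e2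
      rw [show j + 1 + r - j = r + 1 by omega] at e3
      rw [show 2 * (j + 1) = 2 * j + 1 + 1 by ring]
      set N := 2 * (j + 1 + r) with hN
      have hp : 0 < (2 * j + 1) * (2 * (j + 1)) := by positivity
      refine Nat.le_of_mul_le_mul_right ?_ hp
      calc N.choose (2 * j + 1 + 1) * ((2 * j + 1) * (2 * (j + 1)))
          = N.choose (2 * j + 1 + 1) * (2 * j + 1 + 1) * (2 * j + 1) := by ring
        _ = N.choose (2 * j + 1) * (2 * j + 1) * (2 * r + 1) := by rw [e2]; ring
        _ = N.choose (2 * j) * (2 * (r + 1)) * (2 * r + 1) := by rw [e1]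
        _ ≤ (N ^ j * (j + 1 + r).choose j) * (2 * (r + 1)) * N := by
            gcongr; omega
        _ = N ^ (j + 1) * ((j + 1 + r).choose j * (r + 1)) * 2 := by ring
        _ = N ^ (j + 1) * (j + 1 + r).choose (j + 1) * (1 * (2 * (j + 1))) := by
            rw [← e3]; ring
        _ ≤ N ^ (j + 1) * (j + 1 + r).choose (j + 1) * ((2 * j + 1) * (2 * (j + 1))) := by
            gcongr; omega
  exact_mod_cast key

/-- The two-point hypercontractive inequality for even exponents. -/
theorem two_point (m : ℕ) (x y : ℝ) :
    (x + y) ^ (2 * m) + (x - y) ^ (2 * m) ≤ 2 * (x ^ 2 + 2 * m * y ^ 2) ^ m := by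
  rw [add_comm x y, show x - y = -y + x by ring, add_comm (x ^ 2), add_pow, add_pow, add_pow,
    ← Finset.sum_add_distrib, sum_range_even_odd]
  have hodd : ∑ j ∈ Finset.range m, (y ^ (2 * j + 1) * x ^ (2 * m - (2 * j + 1)) *
      ((2 * m).choose (2 * j + 1) : ℝ) + (-y) ^ (2 * j + 1) * x ^ (2 * m - (2 * j + 1)) *
      ((2 * m).choose (2 * j + 1) : ℝ)) = 0 := by
    refine Finset.sum_eq_zero fun j _ => ?_
    rw [Odd.neg_pow ⟨j, rfl⟩]; ring
  rw [hodd, add_zero, Finset.mul_sum]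
  refine Finset.sum_le_sum fun j hj => ?_
  rw [Even.neg_pow ⟨j, by ring⟩, show 2 * m - 2 * j = 2 * (m - j) by omega, mul_pow (2 * (m : ℝ)),
    ← pow_mul, ← pow_mul]
  have h := choose_two_mul_le m j
  have hnn : 0 ≤ y ^ (2 * j) * x ^ (2 * (m - j)) := by
    rw [pow_mul, pow_mul]; positivity
  nlinarith [mul_le_mul_of_nonneg_left h hnn]

/-- Minkowski's inequality for natural powers, in unnormalised form. -/
theorem sum_add_pow_le {α : Type*} [Fintype α] {m : ℕ} (hm : m ≠ 0) {u v : α → ℝ} {c G H : ℝ}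
    (hu : ∀ s, 0 ≤ u s) (hv : ∀ s, 0 ≤ v s) (hG : 0 ≤ G) (hH : 0 ≤ H)
    (h1 : ∑ s, u s ^ m ≤ c * G ^ m) (h2 : ∑ s, v s ^ m ≤ c * H ^ m) :
    ∑ s, (u s + v s) ^ m ≤ c * (G + H) ^ m := by
  have zero : ∀ w : α → ℝ, (∀ s, 0 ≤ w s) → ∑ s, w s ^ m ≤ c * 0 ^ m → ∀ s, w s = 0 := by
    intro w hw h s
    rw [zero_pow hm, mul_zero] at h
    have := (Finset.sum_eq_zero_iff_of_nonneg (fun s _ => pow_nonneg (hw s) m)).1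
      (le_antisymm h (Finset.sum_nonneg fun s _ => pow_nonneg (hw s) m)) s (Finset.mem_univ s)
    exact pow_eq_zero_iff hm |>.1 this
  rcases hG.eq_or_lt with rfl | hG
  · simpa [zero u hu h1] using h2
  rcases hH.eq_or_lt with rfl | hH
  · simpa [zero v hv h2] using h1
  have hGH : 0 < G + H := by positivity
  have pt : ∀ s, (u s + v s) ^ m ≤
      (G + H) ^ m * (G / (G + H) * (u s ^ m / G ^ m) + H / (G + H) * (v s ^ m / H ^ m)) := by
    intro s
    have := (convexOn_pow (𝕜 := ℝ) m).2 (Set.mem_Ici.2 (div_nonneg (hu s) hG.le))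
      (Set.mem_Ici.2 (div_nonneg (hv s) hH.le)) (show 0 ≤ G / (G + H) by positivity)
      (show 0 ≤ H / (G + H) by positivity) (by field_simp)
    simp only [smul_eq_mul] at this
    rw [div_pow, div_pow] at this
    -- Convexity of the `m`-th power applies once the sum is a multiple of a convex combination of
    -- the normalised terms.
    have e : u s + v s = (G + H) * (G / (G + H) * (u s / G) + H / (G + H) * (v s / H)) := by
      field_simp
    rw [e, mul_pow]
    gcongr
  calc ∑ s, (u s + v s) ^ m
      ≤ ∑ s, (G + H) ^ m * (G / (G + H) * (u s ^ m / G ^ m) + H / (G + H) * (v s ^ m / H ^ m)) :=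
        Finset.sum_le_sum fun s _ => pt s
    _ = (G + H) ^ m * (G / (G + H) * ((∑ s, u s ^ m) / G ^ m) +
          H / (G + H) * ((∑ s, v s ^ m) / H ^ m)) := by
        rw [← Finset.mul_sum, Finset.sum_add_distrib, ← Finset.mul_sum, ← Finset.mul_sum,
          ← Finset.sum_div, ← Finset.sum_div]
    _ ≤ (G + H) ^ m * (G / (G + H) * c + H / (G + H) * c) := by
        gcongr
        · exact (div_le_iff₀ (by positivity)).2 h1
        · exact (div_le_iff₀ (by positivity)).2 h2
    _ = c * (G + H) ^ m := by field_simp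

/-- The sign encoded by a Boolean. -/
def sgn (b : Bool) : ℝ := if b then 1 else -1

theorem sum_cons_bool {d : ℕ} (f : (Fin (d + 1) → Bool) → ℝ) :
    ∑ s, f s = ∑ s : Fin d → Bool, (f (Fin.cons true s) + f (Fin.cons false s)) := by
  rw [← (Fin.consEquiv fun _ => Bool).sum_comp, Fintype.sum_prod_type, Fintype.sum_bool,
    ← Finset.sum_add_distrib]
  rfl

/-- Khinchin's inequality for even moments. -/
theorem sum_linear_pow_le {m : ℕ} (hm : m ≠ 0) {d : ℕ} (a : Fin d → ℝ) :
    ∑ s : Fin d → Bool, (∑ j, a j * sgn (s j)) ^ (2 * m) ≤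
      2 ^ d * (2 * m * ∑ j, a j ^ 2) ^ m := by
  induction d with
  | zero => simp [hm]
  | succ d ih =>
    rw [sum_cons_bool]
    simp only [Fin.sum_univ_succ, Fin.cons_zero, Fin.cons_succ, sgn, if_true, Bool.false_eq_true,
      if_false]
    have ih' := ih (fun j => a j.succ)
    simp only [pow_mul] at ih'
    -- Averaging over the first sign by `two_point` leaves the `m`-th power of a sum of two squares;
    -- Minkowski in `L^m` adds their bounds.
    have h1 := sum_add_pow_le hm (u := fun s : Fin d → Bool => (∑ j, a j.succ * sgn (s j)) ^ 2)
      (v := fun _ => 2 * m * a 0 ^ 2) (c := 2 ^ d) (G := 2 * m * ∑ j : Fin d, a j.succ ^ 2)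
      (H := 2 * m * a 0 ^ 2) (fun s => sq_nonneg _) (fun s => by positivity)
      (by positivity) (by positivity) ih' (by simp)
    calc _ ≤ ∑ s : Fin d → Bool, 2 * ((∑ j, a j.succ * sgn (s j)) ^ 2 + 2 * m * a 0 ^ 2) ^ m := by
          refine Finset.sum_le_sum fun s _ => ?_
          refine le_trans (le_of_eq ?_) (two_point m _ _)
          simp only [sgn]
          ring
      _ ≤ 2 * (2 ^ d * (2 * m * ∑ j : Fin d, a j.succ ^ 2 + 2 * m * a 0 ^ 2) ^ m) := by
          rw [← Finset.mul_sum]; gcongr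
      _ = _ := by ring

/-- The quadratic form `∑ i j, A i j x i x j` at a sign vector. -/
def chaos {d : ℕ} (A : Fin d → Fin d → ℝ) (s : Fin d → Bool) : ℝ :=
  ∑ i, ∑ j, A i j * (sgn (s i) * sgn (s j))

/-- Strict triangularity makes the chaos affine in the first sign, with a linear form in the other
signs as slope. This is the shape that `two_point` needs. -/
theorem chaos_cons {d : ℕ} {A : Fin (d + 1) → Fin (d + 1) → ℝ} (hA : ∀ i j, j ≤ i → A i j = 0)
    (b : Bool) (s : Fin d → Bool) :
    chaos A (Fin.cons b s) =
      chaos (fun i j => A i.succ j.succ) s + sgn b * ∑ j, A 0 j.succ * sgn (s j) := by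
  have h0 : ∀ i, A i 0 = 0 := fun i => hA i 0 (Fin.zero_le _)
  simp only [chaos, Fin.sum_univ_succ, Fin.cons_zero, Fin.cons_succ, h0, zero_mul, zero_add]
  rw [add_comm, Finset.mul_sum]
  congr 1
  exact Finset.sum_congr rfl fun j _ => by ring

theorem sum_sq_succ {d : ℕ} {A : Fin (d + 1) → Fin (d + 1) → ℝ} (hA : ∀ i j, j ≤ i → A i j = 0) :
    ∑ i, ∑ j, A i j ^ 2 = ∑ i : Fin d, ∑ j : Fin d, A i.succ j.succ ^ 2 +
      ∑ j : Fin d, A 0 j.succ ^ 2 := by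
  have h0 : ∀ i, A i 0 = 0 := fun i => hA i 0 (Fin.zero_le _)
  simp only [Fin.sum_univ_succ, h0]
  ring_nf

theorem upper_succ {d : ℕ} {A : Fin (d + 1) → Fin (d + 1) → ℝ} (hA : ∀ i j, j ≤ i → A i j = 0)
    (i j : Fin d) (h : j ≤ i) : A i.succ j.succ = 0 :=
  hA _ _ (Fin.succ_le_succ_iff.2 h)

/-- Even moments of a Rademacher chaos of order two. -/
theorem sum_chaos_pow_le {m : ℕ} (hm : m ≠ 0) {d : ℕ} {A : Fin d → Fin d → ℝ}
    (hA : ∀ i j, j ≤ i → A i j = 0) :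
    ∑ s : Fin d → Bool, chaos A s ^ (2 * m) ≤
      2 ^ d * ((2 * m) ^ 2 * ∑ i, ∑ j, A i j ^ 2) ^ m := by
  induction d with
  | zero => simp [hm, chaos]
  | succ d ih =>
    rw [sum_cons_bool, sum_sq_succ hA]
    have ih' := ih (upper_succ hA)
    have hl := sum_linear_pow_le hm (fun j : Fin d => A 0 j.succ)
    simp only [pow_mul] at ih' hl
    -- One factor `2m` comes from `two_point`, the other from Khinchin's inequality for the slope;
    -- hence `(2m)²`.
    have hl' : ∑ s : Fin d → Bool, (2 * m * (∑ j, A 0 j.succ * sgn (s j)) ^ 2) ^ m ≤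
        2 ^ d * ((2 * m) ^ 2 * ∑ j : Fin d, A 0 j.succ ^ 2) ^ m := by
      simp only [mul_pow (2 * (m : ℝ))]
      rw [← Finset.mul_sum]
      calc _ ≤ (2 * (m : ℝ)) ^ m * (2 ^ d * (2 * m * ∑ j : Fin d, A 0 j.succ ^ 2) ^ m) := by
            gcongr
        _ = _ := by generalize 2 * (m : ℝ) = M; ring
    have h1 := sum_add_pow_le hm (fun s => sq_nonneg _) (fun s => by positivity)
      (by positivity) (by positivity) ih' hl'
    calc _ ≤ ∑ s : Fin d → Bool, 2 * (chaos (fun i j => A i.succ j.succ) s ^ 2 +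
            2 * m * (∑ j, A 0 j.succ * sgn (s j)) ^ 2) ^ m := by
          refine Finset.sum_le_sum fun s _ => ?_
          refine le_trans (le_of_eq ?_) (two_point m _ _)
          rw [chaos_cons hA, chaos_cons hA]
          simp only [sgn, if_true, Bool.false_eq_true, if_false]
          ring
      _ ≤ _ := by
          rw [← Finset.mul_sum]
          refine (mul_le_mul_of_nonneg_left h1 zero_le_two).trans (le_of_eq ?_)
          ring

theorem sum_linear_sq {d : ℕ} (a : Fin d → ℝ) :
    ∑ s : Fin d → Bool, (∑ j, a j * sgn (s j)) ^ 2 = 2 ^ d * ∑ j, a j ^ 2 := by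
  induction d with
  | zero => simp
  | succ d ih =>
    have ih' := ih (fun j => a j.succ)
    rw [sum_cons_bool]
    simp only [Fin.sum_univ_succ, Fin.cons_zero, Fin.cons_succ]
    calc _ = ∑ s : Fin d → Bool, (2 * (∑ j, a j.succ * sgn (s j)) ^ 2 + 2 * a 0 ^ 2) := by
          refine Finset.sum_congr rfl fun s _ => ?_
          rw [show sgn true = 1 from rfl, show sgn false = -1 from rfl]; ring
      _ = _ := by
          rw [Finset.sum_add_distrib, ← Finset.mul_sum, ih']
          simp
          ring

theorem sum_chaos_sq {d : ℕ} {A : Fin d → Fin d → ℝ} (hA : ∀ i j, j ≤ i → A i j = 0) :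
    ∑ s : Fin d → Bool, chaos A s ^ 2 = 2 ^ d * ∑ i, ∑ j, A i j ^ 2 := by
  induction d with
  | zero => simp [chaos]
  | succ d ih =>
    rw [sum_cons_bool, sum_sq_succ hA]
    calc _ = ∑ s : Fin d → Bool, (2 * chaos (fun i j => A i.succ j.succ) s ^ 2 +
            2 * (∑ j, A 0 j.succ * sgn (s j)) ^ 2) := by
          refine Finset.sum_congr rfl fun s _ => ?_
          rw [chaos_cons hA, chaos_cons hA, show sgn true = 1 from rfl,
            show sgn false = -1 from rfl]
          ring
      _ = _ := by
          rw [Finset.sum_add_distrib, ← Finset.mul_sum, ← Finset.mul_sum, ih (upper_succ hA),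
            sum_linear_sq]
          ring

/-! ### Exponential moments and Chernoff bounds -/

theorem exp_neg_le_quadratic {y : ℝ} (hy : 0 ≤ y) : Real.exp (-y) ≤ 1 - y + y ^ 2 / 2 := by
  rw [Real.exp_neg]
  have h := Real.quadratic_le_exp_of_nonneg hy
  have hp : 0 < 1 - y + y ^ 2 / 2 := by nlinarith [sq_nonneg (y - 1)]
  rw [inv_le_iff_one_le_mul₀ (Real.exp_pos y)]
  nlinarith [mul_le_mul_of_nonneg_left h hp.le, sq_nonneg (y ^ 2)]

/-- A pointwise substitute for Hölder's inequality: with second moment 1 and fourth moment at most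
256 it gives a mean of `|x|` of at least `1/16 - 1/64 = 3/64`. -/
theorem quartic_le_abs (x : ℝ) : x ^ 2 / 16 - x ^ 4 / 16384 ≤ |x| := by
  rw [← sq_abs x, show x ^ 4 = |x| ^ 4 by rw [← abs_pow, abs_of_nonneg (by positivity)]]
  have hy := abs_nonneg x
  set y := |x|
  have h : 0 ≤ y ^ 3 / 16384 - y / 16 + 1 := by
    nlinarith [mul_nonneg hy (sq_nonneg (y - 18)), sq_nonneg (y - 18)]
  nlinarith [mul_nonneg hy h]

section Chernoff

variable {α : Type*} [Fintype α]

/-- The mean is at most `1 - (3/64)/24 + 1/1152`. The scale 24 makes the linear gain `1/512` more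
than twice the quadratic loss `1/1152`. -/
theorem sum_exp_neg_le {φ : α → ℝ} (h2 : ∑ s, φ s ^ 2 = Fintype.card α)
    (h4 : ∑ s, φ s ^ 4 ≤ Fintype.card α * 256) :
    ∑ s, Real.exp (-(|φ s| / 24)) ≤ Fintype.card α * Real.exp (-(1 / 1152)) := by
  have pt : ∀ s, Real.exp (-(|φ s| / 24)) ≤
      1 - (φ s ^ 2 / 16 - φ s ^ 4 / 16384) / 24 + φ s ^ 2 / 1152 := by
    intro s
    have h := exp_neg_le_quadratic (y := |φ s| / 24) (by positivity)
    have h' := quartic_le_abs (φ s)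
    have e : (|φ s| / 24) ^ 2 / 2 = φ s ^ 2 / 1152 := by rw [div_pow, sq_abs]; ring
    rw [e] at h
    linarith
  have h1 := Real.add_one_le_exp (-(1 / 1152 : ℝ))
  calc _ ≤ ∑ s, (1 - (φ s ^ 2 / 16 - φ s ^ 4 / 16384) / 24 + φ s ^ 2 / 1152) :=
        Finset.sum_le_sum fun s _ => pt s
    _ = Fintype.card α - ((∑ s, φ s ^ 2) / 16 - (∑ s, φ s ^ 4) / 16384) / 24 +
          (∑ s, φ s ^ 2) / 1152 := by
        simp only [Finset.sum_add_distrib, Finset.sum_sub_distrib, ← Finset.sum_div]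
        simp
    _ ≤ Fintype.card α * (-(1 / 1152) + 1) := by
        rw [h2]
        have : (0 : ℝ) ≤ Fintype.card α := by positivity
        linarith
    _ ≤ _ := by gcongr

/-- In the series of `cosh (φ / 6)`, the bound `(2m)^(2m) / (2m)! ≤ e^(2m)` leaves terms at most
`(e²/36)^m ≤ (1/4)^m`, with sum `4/3`. Since `exp |x| ≤ 2 cosh x`, the total is `8/3 < e`. -/
theorem sum_exp_le {φ : α → ℝ}
    (hm : ∀ m : ℕ, ∑ s, φ s ^ (2 * m) ≤ Fintype.card α * ((2 * m : ℝ) ^ 2) ^ m) :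
    ∑ s, Real.exp (|φ s| / 6) ≤ Fintype.card α * Real.exp 1 := by
  have he := Real.exp_one_gt_d9
  have he' := Real.exp_one_lt_d9
  have hs : HasSum (fun m : ℕ => ∑ s, (φ s / 6) ^ (2 * m) / ((2 * m).factorial : ℝ))
      (∑ s, Real.cosh (φ s / 6)) := hasSum_sum fun s _ => Real.hasSum_cosh _
  have hg : HasSum (fun m : ℕ => (Fintype.card α : ℝ) * (1 / 4) ^ m)
      (Fintype.card α * (1 - 1 / 4)⁻¹) :=
    (hasSum_geometric_of_lt_one (by norm_num) (by norm_num)).mul_left _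
  have hle : ∑ s, Real.cosh (φ s / 6) ≤ Fintype.card α * (1 - 1 / 4)⁻¹ := by
    refine hasSum_le (fun m => ?_) hs hg
    have h1 : (2 * m : ℝ) ^ (2 * m) / ((2 * m).factorial : ℝ) ≤ Real.exp (2 * m : ℝ) :=
      Real.pow_div_factorial_le_exp _ (by positivity) _
    have h2 : Real.exp (2 * m : ℝ) = (Real.exp 1 ^ 2) ^ m := by
      rw [← pow_mul, ← Real.exp_nat_mul]; push_cast; ring_nf
    have h3 : Real.exp 1 ^ 2 / 36 ≤ 1 / 4 := by nlinarith
    calc ∑ s, (φ s / 6) ^ (2 * m) / ((2 * m).factorial : ℝ)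
        = (∑ s, φ s ^ (2 * m)) * (1 / 36 ^ m / ((2 * m).factorial : ℝ)) := by
          rw [Finset.sum_mul]
          refine Finset.sum_congr rfl fun s _ => ?_
          rw [div_pow, pow_mul 6]; norm_num; ring
      _ ≤ (Fintype.card α * ((2 * m : ℝ) ^ 2) ^ m) *
            (1 / 36 ^ m / ((2 * m).factorial : ℝ)) := by
          gcongr; exact hm m
      _ = Fintype.card α * ((2 * m : ℝ) ^ (2 * m) / ((2 * m).factorial : ℝ)) / 36 ^ m := by
          rw [← pow_mul]; ring
      _ ≤ Fintype.card α * (Real.exp 1 ^ 2) ^ m / 36 ^ m := by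
          gcongr; exact h1.trans h2.le
      _ = Fintype.card α * (Real.exp 1 ^ 2 / 36) ^ m := by rw [div_pow]; ring
      _ ≤ _ := by gcongr
  calc ∑ s, Real.exp (|φ s| / 6) ≤ ∑ s, 2 * Real.cosh (φ s / 6) := by
        refine Finset.sum_le_sum fun s _ => ?_
        rw [← Real.cosh_abs, abs_div, abs_of_pos (by norm_num : (0 : ℝ) < 6), Real.cosh_eq]
        linarith [Real.exp_pos (-(|φ s| / 6))]
    _ ≤ 2 * (Fintype.card α * (1 - 1 / 4)⁻¹) := by rw [← Finset.mul_sum]; gcongr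
    _ = Fintype.card α * (8 / 3) := by ring
    _ ≤ _ := by gcongr; linarith

open Classical in
/-- Chernoff's bound for i.i.d. uniform samples from a finite type, as a count. -/
theorem card_chernoff {g : α → ℝ} {κ : ℝ} (h : ∑ a, Real.exp (g a) ≤ Fintype.card α * Real.exp κ)
    (n : ℕ) (t : ℝ) :
    ((Finset.univ.filter fun s : Fin n → α => n * t ≤ ∑ i, g (s i)).card : ℝ) ≤
      (Fintype.card α : ℝ) ^ n * Real.exp (κ - t) ^ n := by
  calc ((Finset.univ.filter fun s : Fin n → α => n * t ≤ ∑ i, g (s i)).card : ℝ)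
      = ∑ s : Fin n → α, if n * t ≤ ∑ i, g (s i) then (1 : ℝ) else 0 := by simp
    _ ≤ ∑ s : Fin n → α, Real.exp (-t) ^ n * ∏ i, Real.exp (g (s i)) := by
        refine Finset.sum_le_sum fun s _ => ?_
        rw [← Real.exp_sum, ← Real.exp_nat_mul, ← Real.exp_add]
        split_ifs with hs
        · exact Real.one_le_exp (by linarith)
        · positivity
    _ = (Real.exp (-t) * ∑ a, Real.exp (g a)) ^ n := by
        rw [← Finset.mul_sum, mul_pow, Fintype.sum_pow]
    _ ≤ (Real.exp (-t) * (Fintype.card α * Real.exp κ)) ^ n := by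
        gcongr
    _ = _ := by rw [sub_eq_add_neg, Real.exp_add]; ring

/-- Absorbs the two tails into one exponential, so that the failure probability has no prefactor
even for small `n`. -/
theorem exp_add_exp_le :
    Real.exp (-(1 / 2304)) + Real.exp (-9999) ≤ Real.exp (-(1 / 4000)) := by
  have h1 : Real.exp (-(1 / 2304)) ≤ 2304 / 2305 := by
    rw [Real.exp_neg, inv_le_comm₀ (Real.exp_pos _) (by norm_num)]
    have := Real.add_one_le_exp (1 / 2304 : ℝ)
    norm_num at this ⊢; linarith
  have h2 : Real.exp (-9999) ≤ 1 / 10000 := by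
    rw [Real.exp_neg, inv_le_comm₀ (Real.exp_pos _) (by norm_num)]
    have := Real.add_one_le_exp (9999 : ℝ)
    norm_num at this ⊢; linarith
  have h3 := Real.add_one_le_exp (-(1 / 4000) : ℝ)
  norm_num at h1 h2 h3 ⊢; linarith

open Classical in
theorem card_not_concentrated {φ : α → ℝ} (h2 : ∑ s, φ s ^ 2 = Fintype.card α)
    (hm : ∀ m : ℕ, ∑ s, φ s ^ (2 * m) ≤ Fintype.card α * ((2 * m : ℝ) ^ 2) ^ m)
    {n : ℕ} (hn : n ≠ 0) :
    ((Finset.univ.filter fun s : Fin n → α =>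
        ¬ (1 / 96 ≤ 1 / (n : ℝ) * ∑ i, |φ (s i)| ∧
          1 / (n : ℝ) * ∑ i, |φ (s i)| ≤ 60000)).card : ℝ) ≤
      (Fintype.card α : ℝ) ^ n * Real.exp (-(1 / 4000 * n)) := by
  have hn' : (0 : ℝ) < n := by positivity
  have h4 : ∑ s, φ s ^ 4 ≤ Fintype.card α * 256 := by
    have := hm 2; norm_num at this ⊢; exact this
  -- The thresholds are `24/2304 = 1/96` for the lower tail and `6 · 10000 = 60000` for the upper
  -- one. The latter is generous, to make the upper tail negligible.
  have hl := card_chernoff (sum_exp_neg_le h2 h4) n (-(1 / 2304))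
  have hu := card_chernoff (sum_exp_le hm) n 10000
  rw [show -(1 / 1152) - -(1 / 2304) = (-(1 / 2304) : ℝ) by norm_num] at hl
  rw [show (1 : ℝ) - 10000 = -9999 by norm_num] at hu
  have hsub : (Finset.univ.filter fun s : Fin n → α =>
        ¬ (1 / 96 ≤ 1 / (n : ℝ) * ∑ i, |φ (s i)| ∧
          1 / (n : ℝ) * ∑ i, |φ (s i)| ≤ 60000)) ⊆
      (Finset.univ.filter fun s : Fin n → α =>
        (n : ℝ) * (-(1 / 2304)) ≤ ∑ i, (-(|φ (s i)| / 24))) ∪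
      (Finset.univ.filter fun s : Fin n → α => (n : ℝ) * 10000 ≤ ∑ i, |φ (s i)| / 6) := by
    intro s hs
    simp only [Finset.mem_filter, Finset.mem_univ, true_and, Finset.mem_union,
      Finset.sum_neg_distrib, ← Finset.sum_div] at hs ⊢
    rw [one_div_mul_eq_div, le_div_iff₀ hn', div_le_iff₀ hn'] at hs
    by_contra! hc
    exact hs ⟨by linarith [hc.1], by linarith [hc.2]⟩
  calc _ ≤ (Fintype.card α : ℝ) ^ n * Real.exp (-(1 / 2304)) ^ n +
        (Fintype.card α : ℝ) ^ n * Real.exp (-9999) ^ n := by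
        refine le_trans ?_ (add_le_add hl hu)
        exact_mod_cast (Finset.card_le_card hsub).trans (Finset.card_union_le _ _)
    _ ≤ (Fintype.card α : ℝ) ^ n * (Real.exp (-(1 / 2304)) + Real.exp (-9999)) ^ n := by
        rw [← mul_add]
        gcongr
        exact pow_add_pow_le (by positivity) (by positivity) hn
    _ ≤ (Fintype.card α : ℝ) ^ n * Real.exp (-(1 / 4000)) ^ n := by
        gcongr; exact exp_add_exp_le
    _ = _ := by rw [← Real.exp_nat_mul]; ring_nf

end Chernoff

/-! ### Concentration for a fixed vector -/

/-- The matrix `B(β)` of a pattern of signs. -/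
def signMatrix {n d : ℕ} (s : Fin n → Fin d → Bool) : Matrix (Fin n) (Pairs d) ℝ :=
  bilinMatrix fun i j => sgn (s i j)

/-- The normalised `ℓ1` norm `‖B x‖₁ / n`. -/
noncomputable def meanAbs {n : ℕ} {ι : Type*} [Fintype ι] (B : Matrix (Fin n) ι ℝ) (x : ι → ℝ) : ℝ :=
  1 / (n : ℝ) * l1Norm (B.mulVec x)

/-- The strictly upper triangular matrix with the given entries. -/
def upper {d : ℕ} (a : Pairs d → ℝ) (i j : Fin d) : ℝ := if h : i < j then a ⟨(i, j), h⟩ else 0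

theorem sum_pairs {d : ℕ} (f : Fin d → Fin d → ℝ) :
    ∑ p : Pairs d, f p.1.1 p.1.2 = ∑ i, ∑ j, if i < j then f i j else 0 := by
  rw [← Fintype.sum_prod_type' fun i j => if i < j then f i j else 0, ← Finset.sum_filter]
  exact (Finset.sum_subtype (Finset.univ.filter fun x : Fin d × Fin d => x.1 < x.2)
    (by simp) fun x => f x.1 x.2).symm

theorem sum_upper_sq {d : ℕ} (a : Pairs d → ℝ) :
    ∑ i, ∑ j, upper a i j ^ 2 = ∑ p, a p ^ 2 := by
  have := sum_pairs fun i j => upper a i j ^ 2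
  rw [show ∑ p, a p ^ 2 = ∑ p : Pairs d, upper a p.1.1 p.1.2 ^ 2 from
    Finset.sum_congr rfl fun p _ => by simp [upper, p.2], this]
  refine Finset.sum_congr rfl fun i _ => Finset.sum_congr rfl fun j _ => ?_
  by_cases h : i < j <;> simp [upper, h]

theorem upper_eq_zero {d : ℕ} (a : Pairs d → ℝ) (i j : Fin d) (h : j ≤ i) : upper a i j = 0 := by
  simp [upper, not_lt.2 h]

theorem signMatrix_mulVec {n d : ℕ} (s : Fin n → Fin d → Bool) (a : Pairs d → ℝ) (i : Fin n) :
    (signMatrix s).mulVec a i = chaos (upper a) (s i) := by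
  have := sum_pairs fun j k => upper a j k * (sgn (s i j) * sgn (s i k))
  rw [chaos, show (signMatrix s).mulVec a i =
      ∑ p : Pairs d, upper a p.1.1 p.1.2 * (sgn (s i p.1.1) * sgn (s i p.1.2)) from
    Finset.sum_congr rfl fun p _ => by
      simp [signMatrix, bilinMatrix, upper, p.2, mul_comm], this]
  refine Finset.sum_congr rfl fun j _ => Finset.sum_congr rfl fun k _ => ?_
  by_cases h : j < k <;> simp [upper, h]

theorem l1Norm_smul {ι : Type*} [Fintype ι] (c : ℝ) (x : ι → ℝ) :
    l1Norm (c • x) = |c| * l1Norm x := by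
  simp [l1Norm_eq, abs_mul, Finset.mul_sum]

theorem l2Norm_nonneg {ι : Type*} [Fintype ι] (x : ι → ℝ) : 0 ≤ l2Norm x := norm_nonneg _

theorem l1Norm_nonneg {ι : Type*} [Fintype ι] (x : ι → ℝ) : 0 ≤ l1Norm x := norm_nonneg _

theorem l2Norm_smul {ι : Type*} [Fintype ι] (c : ℝ) (x : ι → ℝ) :
    l2Norm (c • x) = |c| * l2Norm x := by
  simp [l2Norm, norm_smul]

theorem l2Norm_sq {ι : Type*} [Fintype ι] (x : ι → ℝ) : l2Norm x ^ 2 = ∑ i, x i ^ 2 := by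
  rw [l2Norm_eq, Real.sq_sqrt (Finset.sum_nonneg fun i _ => sq_nonneg _)]

theorem l2Norm_eq_zero {ι : Type*} [Fintype ι] {x : ι → ℝ} : l2Norm x = 0 ↔ x = 0 := by
  simp [l2Norm]

theorem meanAbs_smul {n : ℕ} {ι : Type*} [Fintype ι] (B : Matrix (Fin n) ι ℝ) (c : ℝ)
    (x : ι → ℝ) : meanAbs B (c • x) = |c| * meanAbs B x := by
  rw [meanAbs, meanAbs, Matrix.mulVec_smul, l1Norm_smul]; ring

theorem meanAbs_zero {n : ℕ} {ι : Type*} [Fintype ι] (B : Matrix (Fin n) ι ℝ) :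
    meanAbs B 0 = 0 := by
  simpa using meanAbs_smul B 0 0

open Classical in
/-- Concentration of `‖B a‖₁ / n` for a fixed vector, as a count of sign patterns. -/
theorem card_not_concentrated_signMatrix (d n : ℕ) (a : Pairs d → ℝ) :
    ((Finset.univ.filter fun s : Fin n → Fin d → Bool =>
        ¬ (1 / 96 * l2Norm a ≤ meanAbs (signMatrix s) a ∧
          meanAbs (signMatrix s) a ≤ 60000 * l2Norm a)).card : ℝ) ≤
      Fintype.card (Fin n → Fin d → Bool) * Real.exp (-(1 / 4000 * n)) := by
  -- For `n = 0` the claimed bound is the number of all patterns.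
  rcases eq_or_ne n 0 with rfl | hn
  · simp only [CharP.cast_eq_zero, mul_zero, neg_zero, Real.exp_zero, mul_one]
    exact_mod_cast Finset.card_le_univ _
  rcases eq_or_ne a 0 with rfl | ha
  · simp only [meanAbs_zero, l2Norm_eq_zero.2 rfl]
    simp only [mul_zero, le_refl, and_self, not_true_eq_false, Finset.filter_false,
      Finset.card_empty, CharP.cast_eq_zero]
    positivity
  have hr : 0 < l2Norm a := (l2Norm_nonneg a).lt_of_ne fun h => ha (l2Norm_eq_zero.1 h.symm)
  set x : Pairs d → ℝ := (l2Norm a)⁻¹ • a with hx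
  have hx1 : ∑ p, x p ^ 2 = 1 := by
    rw [← l2Norm_sq, hx, l2Norm_smul, abs_of_pos (by positivity), inv_mul_cancel₀ hr.ne', one_pow]
  have hax : a = l2Norm a • x := by rw [hx, smul_smul, mul_inv_cancel₀ hr.ne', one_smul]
  have hc : (Fintype.card (Fin d → Bool) : ℝ) = 2 ^ d := by simp
  have h := card_not_concentrated (α := Fin d → Bool) (φ := chaos (upper x))
    (by rw [sum_chaos_sq (upper_eq_zero x), sum_upper_sq, hx1, hc, mul_one]) (fun m => by
      rcases eq_or_ne m 0 with rfl | hm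
      · simp
      · have := sum_chaos_pow_le hm (upper_eq_zero x)
        rwa [sum_upper_sq, hx1, mul_one, ← hc] at this) hn
  have hF : ∀ s : Fin n → Fin d → Bool, meanAbs (signMatrix s) a =
      (1 / (n : ℝ) * ∑ i, |chaos (upper x) (s i)|) * l2Norm a := by
    intro s
    conv_lhs => rw [hax]
    rw [meanAbs_smul, abs_of_pos hr, meanAbs, l1Norm_eq]
    simp only [signMatrix_mulVec]
    ring
  simp only [hF, mul_le_mul_iff_left₀ hr]
  rw [Fintype.card_fun, Fintype.card_fin, Nat.cast_pow]
  exact h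

/-! ### Norm inequalities and sparse vectors -/

section Norms

variable {ι : Type*} [Fintype ι]

theorem l2Norm_add_le (x y : ι → ℝ) : l2Norm (x + y) ≤ l2Norm x + l2Norm y := by
  simp only [l2Norm, WithLp.toLp_add]; exact norm_add_le _ _

theorem l1Norm_add_le (x y : ι → ℝ) : l1Norm (x + y) ≤ l1Norm x + l1Norm y := by
  simp only [l1Norm, WithLp.toLp_add]; exact norm_add_le _ _

theorem l2Norm_le_of_abs_le {x y : ι → ℝ} (h : ∀ i, |x i| ≤ |y i|) : l2Norm x ≤ l2Norm y := by
  rw [l2Norm_eq, l2Norm_eq]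
  exact Real.sqrt_le_sqrt (Finset.sum_le_sum fun i _ => sq_le_sq.2 (h i))

theorem sum_abs_le_sqrt_mul_l2Norm (S : Finset ι) (x : ι → ℝ) :
    ∑ i ∈ S, |x i| ≤ Real.sqrt S.card * l2Norm x := by
  refine abs_le_of_sq_le_sq' ?_ (mul_nonneg (Real.sqrt_nonneg _) (l2Norm_nonneg _)) |>.2
  rw [mul_pow, Real.sq_sqrt (Nat.cast_nonneg _), l2Norm_sq]
  calc _ ≤ (S.card : ℝ) * ∑ i ∈ S, |x i| ^ 2 := sq_sum_le_card_mul_sum_sq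
    _ ≤ _ := by
      gcongr
      simp only [sq_abs]
      exact Finset.sum_le_sum_of_subset_of_nonneg (Finset.subset_univ _) fun i _ _ => sq_nonneg _

theorem exists_support_of_isSparse {k : ℕ} {x : ι → ℝ} (hx : IsSparse k x) :
    ∃ S : Finset ι, S.card ≤ k ∧ ∀ i, i ∉ S → x i = 0 := by
  classical
  refine ⟨Finset.univ.filter fun i => x i ≠ 0, ?_, fun i hi => by simpa using hi⟩
  rw [IsSparse, Set.ncard_eq_toFinset_card'] at hx
  simpa using hx

theorem isSparse_of_support {ι : Type*} {k : ℕ} {x : ι → ℝ} (S : Finset ι) (hS : S.card ≤ k)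
    (h : ∀ i, i ∉ S → x i = 0) : IsSparse k x := by
  refine le_trans ?_ hS
  rw [← Set.ncard_coe_finset]
  exact Set.ncard_le_ncard (fun i hi => by_contra fun hc => hi (h i hc)) S.finite_toSet

theorem meanAbs_add_le {n : ℕ} (B : Matrix (Fin n) ι ℝ) (x y : ι → ℝ) :
    meanAbs B (x + y) ≤ meanAbs B x + meanAbs B y := by
  rw [meanAbs, meanAbs, meanAbs, ← mul_add, Matrix.mulVec_add]
  gcongr
  exact l1Norm_add_le _ _

theorem exists_meanAbs_le {n : ℕ} (B : Matrix (Fin n) ι ℝ) :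
    ∃ C : ℝ, ∀ x, meanAbs B x ≤ C * l2Norm x := by
  refine ⟨1 / (n : ℝ) * ∑ i, ∑ p, |B i p|, fun x => ?_⟩
  rw [meanAbs, mul_assoc, l1Norm_eq, Finset.sum_mul]
  gcongr with i
  rw [Finset.sum_mul]
  refine (Finset.abs_sum_le_sum_abs _ _).trans (Finset.sum_le_sum fun p _ => ?_)
  rw [abs_mul]
  gcongr
  simpa using sum_abs_le_sqrt_mul_l2Norm {p} x

end Norms

/-! ### A net of integer vectors for the sparse vectors -/

section Net

variable {ι : Type*} [Fintype ι] [DecidableEq ι]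

/-- The integer vectors of `ℓ1` norm at most `L`. -/
noncomputable def intNet (ι : Type*) [Fintype ι] [DecidableEq ι] (L : ℕ) : Finset (ι → ℤ) :=
  (Fintype.piFinset fun _ => Finset.Icc (-(L : ℤ)) L).filter fun z => ∑ i, (z i).natAbs ≤ L

theorem mem_intNet {L : ℕ} {z : ι → ℤ} : z ∈ intNet ι L ↔ ∑ i, (z i).natAbs ≤ L := by
  simp only [intNet, Finset.mem_filter, Fintype.mem_piFinset, Finset.mem_Icc, and_iff_right_iff_imp]
  intro h i
  have := Finset.single_le_sum (f := fun i => (z i).natAbs) (fun _ _ => Nat.zero_le _)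
    (Finset.mem_univ i)
  omega

/-- The full two-sided series is `(1 + t) / (1 - t) ≤ 1 + 4t`. The subtracted term lets the
induction close. -/
theorem sum_Icc_pow_natAbs_le {t : ℝ} (h0 : 0 ≤ t) (h1 : t ≤ 1 / 2) (L : ℕ) :
    ∑ z ∈ Finset.Icc (-(L : ℤ)) L, t ^ z.natAbs ≤ 1 + 4 * t - 4 * t ^ (L + 1) := by
  induction L with
  | zero => simp
  | succ L ih =>
    have e : Finset.Icc (-((L + 1 : ℕ) : ℤ)) ((L + 1 : ℕ) : ℤ) =
        insert (-((L + 1 : ℕ) : ℤ)) (insert ((L + 1 : ℕ) : ℤ) (Finset.Icc (-(L : ℤ)) L)) := by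
      ext z; simp only [Finset.mem_Icc, Finset.mem_insert]; push_cast; omega
    rw [e, Finset.sum_insert (by simp; omega), Finset.sum_insert (by simp), Int.natAbs_neg,
      Int.natAbs_natCast, pow_succ t (L + 1)]
    nlinarith [pow_nonneg h0 (L + 1), mul_le_mul_of_nonneg_left h1 (pow_nonneg h0 (L + 1))]

/-- A generating function bound: each net point has weight at least `t^L` under the product weight
`t^|z i|`, whose total mass factorises over the coordinates. -/
theorem card_intNet_mul_le {t : ℝ} (h0 : 0 ≤ t) (h1 : t ≤ 1 / 2) (L : ℕ) :
    ((intNet ι L).card : ℝ) * t ^ L ≤ Real.exp (4 * t * Fintype.card ι) := by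
  calc ((intNet ι L).card : ℝ) * t ^ L = ∑ z ∈ intNet ι L, t ^ L := by simp
    _ ≤ ∑ z ∈ intNet ι L, ∏ i, t ^ (z i).natAbs := by
        refine Finset.sum_le_sum fun z hz => ?_
        rw [Finset.prod_pow_eq_pow_sum]
        exact pow_le_pow_of_le_one h0 (by linarith) (mem_intNet.1 hz)
    _ ≤ ∑ z ∈ Fintype.piFinset fun _ : ι => Finset.Icc (-(L : ℤ)) L, ∏ i, t ^ (z i).natAbs :=
        Finset.sum_le_sum_of_subset_of_nonneg (Finset.filter_subset _ _) fun z _ _ => by positivity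
    _ = ∏ _i : ι, ∑ z ∈ Finset.Icc (-(L : ℤ)) L, t ^ z.natAbs :=
        (Finset.prod_univ_sum (fun _ => Finset.Icc (-(L : ℤ)) L) fun _ z => t ^ z.natAbs).symm
    _ = (∑ z ∈ Finset.Icc (-(L : ℤ)) L, t ^ z.natAbs) ^ Fintype.card ι := by simp
    _ ≤ Real.exp (4 * t) ^ Fintype.card ι := by
        refine pow_le_pow_left₀ (Finset.sum_nonneg fun _ _ => by positivity) ?_ _
        have := sum_Icc_pow_natAbs_le h0 h1 L
        have := Real.add_one_le_exp (4 * t)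
        have := pow_nonneg h0 (L + 1)
        linarith
    _ = _ := by rw [← Real.exp_nat_mul]; ring_nf

/-- Rounding is towards zero, so that zero entries stay zero and no entry grows. -/
theorem exists_int_truncation (x : ℝ) : ∃ z : ℤ, |(z : ℝ)| ≤ |x| ∧ |x - z| ≤ 1 := by
  rcases le_total 0 x with h | h
  · refine ⟨⌊x⌋, ?_, ?_⟩
    · rw [abs_of_nonneg (by exact_mod_cast Int.floor_nonneg.2 h), abs_of_nonneg h]
      exact Int.floor_le x
    · rw [abs_of_nonneg (by linarith [Int.floor_le x])]
      linarith [Int.lt_floor_add_one x]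
  · have h' : (⌈x⌉ : ℝ) ≤ 0 := by exact_mod_cast Int.ceil_le.2 (by simpa using h)
    refine ⟨⌈x⌉, ?_, ?_⟩
    · rw [abs_of_nonpos h', abs_of_nonpos h]
      linarith [Int.le_ceil x]
    · rw [abs_of_nonpos (by linarith [Int.le_ceil x])]
      linarith [Int.ceil_lt_add_one x]

/-- Scaled integer vectors of `ℓ1` norm at most `R k` approximate all `k`-sparse vectors. -/
theorem exists_intNet_approx {k R : ℕ} (hk : k ≠ 0) (hR : R ≠ 0) {x : ι → ℝ}
    (hx : IsSparse k x) :
    ∃ z ∈ intNet ι (R * k), ∃ δ : ℝ, 0 ≤ δ ∧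
      l2Norm (δ • fun i => (z i : ℝ)) ≤ l2Norm x ∧
      IsSparse k (x - δ • fun i => (z i : ℝ)) ∧
      l2Norm (x - δ • fun i => (z i : ℝ)) ≤ l2Norm x / R := by
  rcases eq_or_ne x 0 with rfl | hx0
  · refine ⟨0, mem_intNet.2 (by simp), 0, le_rfl, ?_⟩
    rw [zero_smul, sub_zero]
    refine ⟨le_rfl, hx, ?_⟩
    rw [l2Norm_eq_zero.2 rfl, zero_div]
  have hr : 0 < l2Norm x := (l2Norm_nonneg x).lt_of_ne fun h => hx0 (l2Norm_eq_zero.1 h.symm)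
  obtain ⟨S, hS, hSx⟩ := exists_support_of_isSparse hx
  have hk' : (0 : ℝ) < k := by positivity
  have hR' : (0 : ℝ) < R := by positivity
  have hsk : 0 < Real.sqrt k := Real.sqrt_pos.2 hk'
  -- An error of at most `δ` on `k` entries has `ℓ2` norm at most `‖x‖₂ / R`, while `‖x‖₁ / δ ≤ √k
  -- ‖x‖₂ / δ = R k` bounds the `ℓ1` norm of the net point.
  set δ : ℝ := l2Norm x / (R * Real.sqrt k) with hδ
  have hδ0 : 0 < δ := by positivity
  choose z hz1 hz2 using fun i => exists_int_truncation (x i / δ)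
  have a1 : ∀ i, |δ * (z i : ℝ)| ≤ |x i| := fun i => by
    have := hz1 i
    rw [abs_div, abs_of_pos hδ0, le_div_iff₀ hδ0] at this
    rw [abs_mul, abs_of_pos hδ0]; linarith
  have a2 : ∀ i, |x i - δ * (z i : ℝ)| ≤ δ := fun i => by
    have e : x i - δ * (z i : ℝ) = δ * (x i / δ - z i) := by field_simp
    rw [e, abs_mul, abs_of_pos hδ0]
    exact mul_le_of_le_one_right hδ0.le (hz2 i)
  have a3 : ∀ i, i ∉ S → (x - δ • fun i => (z i : ℝ)) i = 0 := fun i hi => by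
    have := a1 i
    rw [hSx i hi, abs_zero] at this
    have := abs_eq_zero.1 (le_antisymm this (abs_nonneg _))
    simp [hSx i hi, this]
  refine ⟨z, mem_intNet.2 ?_, δ, hδ0.le, l2Norm_le_of_abs_le a1, isSparse_of_support S hS a3, ?_⟩
  · have h1 : ∑ i, |x i| ≤ Real.sqrt k * l2Norm x := by
      rw [← Finset.sum_subset (Finset.subset_univ S) fun i _ hi => by rw [hSx i hi, abs_zero]]
      refine (sum_abs_le_sqrt_mul_l2Norm S x).trans ?_
      gcongr
    have h2 : δ * ∑ i, |(z i : ℝ)| ≤ δ * (R * k : ℕ) := by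
      rw [Finset.mul_sum]
      refine (Finset.sum_le_sum fun i _ => ?_).trans (h1.trans (le_of_eq ?_))
      · have := a1 i
        rwa [abs_mul, abs_of_pos hδ0] at this
      · rw [hδ]; push_cast; field_simp
        rw [Real.sq_sqrt hk'.le]
    have h3 := le_of_mul_le_mul_left h2 hδ0
    have h4 : ((∑ i, (z i).natAbs : ℕ) : ℝ) = ∑ i, |(z i : ℝ)| := by
      push_cast
      exact Finset.sum_congr rfl fun i _ => by rw [Nat.cast_natAbs, Int.cast_abs]
    exact_mod_cast h4.le.trans h3
  · rw [l2Norm_eq, ← Finset.sum_subset (Finset.subset_univ S) fun i _ hi => by rw [a3 i hi]; simp]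
    refine Real.sqrt_le_iff.2 ⟨by positivity, ?_⟩
    calc ∑ i ∈ S, (x - δ • fun i => (z i : ℝ)) i ^ 2 ≤ ∑ _i ∈ S, δ ^ 2 :=
          Finset.sum_le_sum fun i _ => sq_le_sq.2 (by rw [abs_of_pos hδ0]; exact a2 i)
      _ = S.card * δ ^ 2 := by simp
      _ ≤ k * δ ^ 2 := by gcongr
      _ = _ := by
        rw [hδ, div_pow, mul_pow, Real.sq_sqrt hk'.le]; field_simp

/-- Norm equivalence on the net implies norm equivalence for all sparse vectors. -/
theorem meanAbs_bounds_of_intNet {n k R : ℕ} (hk : k ≠ 0) {c₁ c₂ : ℝ} (hc₁ : 0 < c₁)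
    (hc₂ : 0 < c₂) (hR : 2 * (c₁ + 2 * c₂) ≤ c₁ * R) (B : Matrix (Fin n) ι ℝ)
    (h : ∀ z ∈ intNet ι (R * k), c₁ * l2Norm (fun i => (z i : ℝ)) ≤ meanAbs B (fun i => (z i : ℝ)) ∧
      meanAbs B (fun i => (z i : ℝ)) ≤ c₂ * l2Norm (fun i => (z i : ℝ)))
    {x : ι → ℝ} (hx : IsSparse k x) :
    c₁ / 2 * l2Norm x ≤ meanAbs B x ∧ meanAbs B x ≤ 2 * c₂ * l2Norm x := by
  have hR2 : (2 : ℝ) ≤ R := by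
    by_contra hc
    nlinarith
  have hR0 : R ≠ 0 := by rintro rfl; norm_num at hR2
  -- A bound `M` on sparse vectors improves to `c₂ + M / 2`, since the residual is sparse with at
  -- most half the norm. Iterating from any crude bound converges to the fixed point `2 c₂`.
  have step : ∀ M : ℝ, 0 ≤ M → (∀ x : ι → ℝ, IsSparse k x → meanAbs B x ≤ M * l2Norm x) →
      ∀ x : ι → ℝ, IsSparse k x → meanAbs B x ≤ (c₂ + M / 2) * l2Norm x := by
    intro M hM hx' x hx
    obtain ⟨z, hz, δ, hδ, h1, h2, h3⟩ := exists_intNet_approx hk hR0 hx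
    have h4 := meanAbs_add_le B (δ • fun i => (z i : ℝ)) (x - δ • fun i => (z i : ℝ))
    rw [add_sub_cancel, meanAbs_smul] at h4
    rw [l2Norm_smul] at h1
    have h5 := mul_le_mul_of_nonneg_left (h z hz).2 (abs_nonneg δ)
    have h6 := mul_le_mul_of_nonneg_left h1 hc₂.le
    have h7 := mul_le_mul_of_nonneg_left h3 hM
    have h8 : l2Norm x / R ≤ l2Norm x / 2 := by
      gcongr; exact l2Norm_nonneg _
    have h9 := mul_le_mul_of_nonneg_left h8 hM
    linarith [hx' _ h2]
  have upper : ∀ x : ι → ℝ, IsSparse k x → meanAbs B x ≤ 2 * c₂ * l2Norm x := by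
    obtain ⟨C, hC⟩ := exists_meanAbs_le B
    have iter : ∀ (j : ℕ) (x : ι → ℝ), IsSparse k x →
        meanAbs B x ≤ (2 * c₂ + |C| * (1 / 2) ^ j) * l2Norm x := by
      intro j
      induction j with
      | zero =>
        intro x _
        refine (hC x).trans ?_
        gcongr
        · exact l2Norm_nonneg _
        · rw [pow_zero, mul_one]; linarith [le_abs_self C]
      | succ j ih =>
        intro x hx
        refine (step _ (by positivity) ih x hx).trans (le_of_eq ?_)
        rw [pow_succ]; ring
    intro x hx
    have ht : Filter.Tendsto (fun j : ℕ => (2 * c₂ + |C| * (1 / 2 : ℝ) ^ j) * l2Norm x)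
        Filter.atTop (nhds ((2 * c₂ + |C| * 0) * l2Norm x)) :=
      (((tendsto_pow_atTop_nhds_zero_of_lt_one (by norm_num) (by norm_num)).const_mul _).const_add
        _).mul_const _
    rw [mul_zero, add_zero] at ht
    exact ge_of_tendsto' ht fun j => iter j x hx
  refine ⟨?_, upper x hx⟩
  -- The residual costs `c₁ / R` in the norm and `2 c₂ / R` in the image; `hR` makes the total at
  -- most `c₁ / 2`.
  obtain ⟨z, hz, δ, hδ, -, h2, h3⟩ := exists_intNet_approx hk hR0 hx
  have h4 := meanAbs_add_le B x ((-1 : ℝ) • (x - δ • fun i => (z i : ℝ)))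
  rw [meanAbs_smul, abs_neg, abs_one, one_mul,
    show x + (-1 : ℝ) • (x - δ • fun i => (z i : ℝ)) = δ • fun i => (z i : ℝ) by
      rw [neg_one_smul]; abel, meanAbs_smul] at h4
  have h5 := l2Norm_add_le (δ • fun i => (z i : ℝ)) (x - δ • fun i => (z i : ℝ))
  rw [add_sub_cancel, l2Norm_smul] at h5
  have h6 := mul_le_mul_of_nonneg_left (h z hz).1 (abs_nonneg δ)
  have h7 := mul_le_mul_of_nonneg_left h5 hc₁.le
  have h8 := upper _ h2
  have h9 := mul_le_mul_of_nonneg_left h3 (show 0 ≤ c₁ + 2 * c₂ by positivity)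
  have h10 : (c₁ + 2 * c₂) * (l2Norm x / R) ≤ c₁ / 2 * l2Norm x := by
    rw [mul_div_assoc', div_le_iff₀ (by positivity)]
    have := mul_le_mul_of_nonneg_right hR (l2Norm_nonneg x)
    linarith
  linarith

end Net

/-! ### Union bound for the restricted isometry property -/

theorem card_pairs (d : ℕ) : Fintype.card (Pairs d) = d.choose 2 := by
  have h := sum_pairs (d := d) fun _ _ => 1
  have h1 : ∀ i : Fin d, (∑ j : Fin d, if i < j then (1 : ℝ) else 0) = ((d - 1 - i : ℕ) : ℝ) := by
    intro i
    rw [Finset.sum_boole, ← Fin.card_Ioi]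
    congr 2
    ext j; simp
  simp only [h1, Finset.sum_const, Finset.card_univ, nsmul_eq_mul, mul_one] at h
  have h2 : Fintype.card (Pairs d) = ∑ i : Fin d, (d - 1 - i : ℕ) := by exact_mod_cast h
  rw [h2, Fin.sum_univ_eq_sum_range (fun i => d - 1 - i) d, Finset.sum_range_reflect (fun i => i) d,
    Finset.sum_range_id, Nat.choose_two_right]

theorem two_mul_choose_two_le (d : ℕ) : 2 * (d.choose 2 : ℝ) ≤ (d : ℝ) ^ 2 := by
  rw [Nat.cast_choose_two]
  nlinarith [(Nat.cast_nonneg d : (0 : ℝ) ≤ d)]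

theorem half_le_log_sq_div {d k : ℕ} (hk : 1 ≤ k) (hkd : k ≤ d.choose 2) :
    1 / 2 ≤ Real.log ((d : ℝ) ^ 2 / k) := by
  have hk' : (0 : ℝ) < k := by exact_mod_cast hk
  have h : (2 : ℝ) ≤ (d : ℝ) ^ 2 / k := by
    rw [le_div_iff₀ hk']
    have : (k : ℝ) ≤ d.choose 2 := by exact_mod_cast hkd
    linarith [two_mul_choose_two_le d]
  have := Real.log_le_log (by norm_num) h
  linarith [Real.log_two_gt_d9]

/-- Taking `t = k / d²`, which is at most `1/2`, turns `t^(-R k)` into `exp (R k log (d²/k))`. The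
remaining factor is at most `exp (2k)`, absorbed as `4 k log (d²/k)` because the logarithm is at
least `1/2`. -/
theorem card_intNet_pairs_le {d k : ℕ} (hk : 1 ≤ k) (hkd : k ≤ d.choose 2) (R : ℕ) :
    ((intNet (Pairs d) (R * k)).card : ℝ) ≤
      Real.exp ((R + 4) * (k * Real.log ((d : ℝ) ^ 2 / k))) := by
  have hk' : (0 : ℝ) < k := by exact_mod_cast hk
  have h2 := two_mul_choose_two_le d
  have hkd' : (k : ℝ) ≤ d.choose 2 := by exact_mod_cast hkd
  have hd : (0 : ℝ) < (d : ℝ) ^ 2 := by linarith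
  have hl := half_le_log_sq_div hk hkd
  have h := card_intNet_mul_le (ι := Pairs d) (t := k / (d : ℝ) ^ 2) (by positivity)
    (by rw [div_le_iff₀ hd]; linarith) (R * k)
  have e : (k / (d : ℝ) ^ 2) = Real.exp (-Real.log ((d : ℝ) ^ 2 / k)) := by
    rw [Real.exp_neg, Real.exp_log (by positivity), inv_div]
  have e2 : 4 * (k / (d : ℝ) ^ 2) * Fintype.card (Pairs d) ≤ 2 * k := by
    rw [card_pairs, mul_div_assoc', div_mul_eq_mul_div, div_le_iff₀ hd]
    nlinarith
  have h' := h.trans (Real.exp_le_exp.2 e2)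
  rw [e, ← Real.exp_nat_mul, ← le_div_iff₀ (Real.exp_pos _), ← Real.exp_sub] at h'
  refine h'.trans (Real.exp_le_exp.2 ?_)
  push_cast
  nlinarith

/-- The sampling constant in the restricted isometry property. -/
theorem exists_card_not_rip_le : ∃ C : ℝ, 0 < C ∧ ∀ d n k : ℕ, 1 ≤ k → k ≤ d.choose 2 →
    C * (k * Real.log ((d : ℝ) ^ 2 / k)) ≤ n → ∀ bad : Finset (Fin n → Fin d → Bool),
    (∀ s ∈ bad, ¬ ∀ x : Pairs d → ℝ, IsSparse k x →
      1 / 192 * l2Norm x ≤ meanAbs (signMatrix s) x ∧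
      meanAbs (signMatrix s) x ≤ 120000 * l2Norm x) →
    (bad.card : ℝ) ≤ Fintype.card (Fin n → Fin d → Bool) * Real.exp (-(1 / 8000 * n)) := by
  classical
  obtain ⟨R, hR⟩ := exists_nat_ge (2 * (1 / 96 + 2 * 60000) / (1 / 96) : ℝ)
  have hR' : 2 * (1 / 96 + 2 * 60000) ≤ 1 / 96 * (R : ℝ) := by linarith
  -- This size of `n` lets the net's cardinality consume half of the exponent `n / 4000`.
  refine ⟨8000 * (R + 4), by positivity, fun d n k hk hkd hn bad hbad => ?_⟩
  set net := intNet (Pairs d) (R * k)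
  have hsub : bad ⊆ net.biUnion fun z => Finset.univ.filter fun s : Fin n → Fin d → Bool =>
        ¬ (1 / 96 * l2Norm (fun i => (z i : ℝ)) ≤ meanAbs (signMatrix s) (fun i => (z i : ℝ)) ∧
          meanAbs (signMatrix s) (fun i => (z i : ℝ)) ≤ 60000 * l2Norm (fun i => (z i : ℝ))) := by
    intro s hs
    by_contra hc
    refine hbad s hs fun x hx => ?_
    have := meanAbs_bounds_of_intNet (by omega) (by norm_num) (by norm_num) hR' (signMatrix s)
      (fun z hz => by_contra fun h => hc (Finset.mem_biUnion.2
        ⟨z, hz, Finset.mem_filter.2 ⟨Finset.mem_univ _, h⟩⟩)) hx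
    norm_num at this ⊢
    exact this
  calc (bad.card : ℝ) ≤ ∑ z ∈ net, ((Finset.univ.filter fun s : Fin n → Fin d → Bool =>
        ¬ (1 / 96 * l2Norm (fun i => (z i : ℝ)) ≤ meanAbs (signMatrix s) (fun i => (z i : ℝ)) ∧
          meanAbs (signMatrix s) (fun i => (z i : ℝ)) ≤
            60000 * l2Norm (fun i => (z i : ℝ)))).card : ℝ) := by
        exact_mod_cast (Finset.card_le_card hsub).trans Finset.card_biUnion_le
    _ ≤ ∑ z ∈ net, Fintype.card (Fin n → Fin d → Bool) * Real.exp (-(1 / 4000 * n)) :=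
        Finset.sum_le_sum fun z _ => card_not_concentrated_signMatrix d n _
    _ = Fintype.card (Fin n → Fin d → Bool) * (net.card * Real.exp (-(1 / 4000 * n))) := by
        rw [Finset.sum_const, nsmul_eq_mul]; ring
    _ ≤ Fintype.card (Fin n → Fin d → Bool) *
          (Real.exp ((R + 4) * (k * Real.log ((d : ℝ) ^ 2 / k))) * Real.exp (-(1 / 4000 * n))) := by
        gcongr
        exact card_intNet_pairs_le hk hkd R
    _ ≤ _ := by
        rw [← Real.exp_add]
        gcongr
        linarith

/-! ### Maurey's empirical method -/

section Sampling

variable {ι : Type*} [Fintype ι] {p : ι → ℝ}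

theorem sum_fin_cons {K : ℕ} (g : (Fin (K + 1) → ι) → ℝ) :
    ∑ f, g f = ∑ i, ∑ f : Fin K → ι, g (Fin.cons i f) := by
  rw [← (Fin.consEquiv fun _ => ι).sum_comp, Fintype.sum_prod_type]
  rfl

theorem sum_prod_weights (hp : ∑ i, p i = 1) (K : ℕ) : ∑ f : Fin K → ι, ∏ j, p (f j) = 1 := by
  rw [← Fintype.sum_pow, hp, one_pow]

theorem sum_prod_mul_sum (hp : ∑ i, p i = 1) {Y : ι → ℝ} (hY : ∑ i, p i * Y i = 0) (K : ℕ) :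
    ∑ f : Fin K → ι, (∏ j, p (f j)) * ∑ j, Y (f j) = 0 := by
  induction K with
  | zero => simp
  | succ K ih =>
    rw [sum_fin_cons]
    simp only [Fin.prod_univ_succ, Fin.sum_univ_succ, Fin.cons_zero, Fin.cons_succ]
    calc _ = ∑ i, ((p i * Y i) * ∑ f : Fin K → ι, ∏ j, p (f j) +
            p i * ∑ f : Fin K → ι, (∏ j, p (f j)) * ∑ j, Y (f j)) := by
          refine Finset.sum_congr rfl fun i _ => ?_
          rw [Finset.mul_sum, Finset.mul_sum, ← Finset.sum_add_distrib]
          exact Finset.sum_congr rfl fun f _ => by ring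
      _ = 0 := by
          rw [ih, sum_prod_weights hp]
          simpa using hY

/-- Additivity of variance: the cross terms vanish because `Y` is centred and the samples are
independent. -/
theorem sum_prod_mul_sum_sq (hp : ∑ i, p i = 1) {Y : ι → ℝ} (hY : ∑ i, p i * Y i = 0) (K : ℕ) :
    ∑ f : Fin K → ι, (∏ j, p (f j)) * (∑ j, Y (f j)) ^ 2 = K * ∑ i, p i * Y i ^ 2 := by
  induction K with
  | zero => simp
  | succ K ih =>
    rw [sum_fin_cons]
    simp only [Fin.prod_univ_succ, Fin.sum_univ_succ, Fin.cons_zero, Fin.cons_succ]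
    calc _ = ∑ i, ((p i * Y i ^ 2) * ∑ f : Fin K → ι, ∏ j, p (f j) +
            2 * (p i * Y i) * (∑ f : Fin K → ι, (∏ j, p (f j)) * ∑ j, Y (f j)) +
            p i * ∑ f : Fin K → ι, (∏ j, p (f j)) * (∑ j, Y (f j)) ^ 2) := by
          refine Finset.sum_congr rfl fun i _ => ?_
          rw [Finset.mul_sum, Finset.mul_sum, Finset.mul_sum, ← Finset.sum_add_distrib,
            ← Finset.sum_add_distrib]
          exact Finset.sum_congr rfl fun f _ => by ring
      _ = _ := by
          rw [ih, sum_prod_weights hp, sum_prod_mul_sum hp hY]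
          simp only [mul_one, mul_zero, add_zero, Finset.sum_add_distrib, ← Finset.sum_mul, hp]
          push_cast
          ring

/-- The inequality `|s| ≤ s² / (2r) + r / 2` with `r = √K` reduces the first absolute moment to the
variance. -/
theorem sum_prod_mul_abs_sum_le (hp0 : ∀ i, 0 ≤ p i) (hp : ∑ i, p i = 1) {Y : ι → ℝ}
    (hY : ∑ i, p i * Y i = 0) (hY2 : ∑ i, p i * Y i ^ 2 ≤ 1) {K : ℕ} (hK : K ≠ 0) :
    ∑ f : Fin K → ι, (∏ j, p (f j)) * |∑ j, Y (f j)| ≤ Real.sqrt K := by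
  have hK' : (0 : ℝ) < K := by positivity
  have hs := Real.sqrt_pos.2 hK'
  have hss := Real.mul_self_sqrt hK'.le
  set r := Real.sqrt K
  calc ∑ f : Fin K → ι, (∏ j, p (f j)) * |∑ j, Y (f j)|
      ≤ ∑ f : Fin K → ι, ((∏ j, p (f j)) * (∑ j, Y (f j)) ^ 2 * (1 / (2 * r)) +
          (∏ j, p (f j)) * (r / 2)) := by
        refine Finset.sum_le_sum fun f _ => ?_
        rw [mul_assoc, ← mul_add]
        refine mul_le_mul_of_nonneg_left ?_ (Finset.prod_nonneg fun j _ => hp0 _)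
        rw [← sq_abs (∑ j, Y (f j))]
        have e : |∑ j, Y (f j)| ^ 2 * (1 / (2 * r)) + r / 2 - |∑ j, Y (f j)| =
            (|∑ j, Y (f j)| - r) ^ 2 / (2 * r) := by field_simp; ring
        have : 0 ≤ (|∑ j, Y (f j)| - r) ^ 2 / (2 * r) := by positivity
        linarith
    _ = K * (∑ i, p i * Y i ^ 2) * (1 / (2 * r)) + r / 2 := by
        rw [Finset.sum_add_distrib, ← Finset.sum_mul, ← Finset.sum_mul, sum_prod_weights hp,
          sum_prod_mul_sum_sq hp hY, one_mul]
    _ ≤ K * 1 * (1 / (2 * r)) + r / 2 := by gcongr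
    _ = r := by rw [← hss]; field_simp; ring

end Sampling

/-- Maurey's empirical method: a vector is a mean of `K`-sparse vectors that are close to it under
every functional with coefficients in `[-1, 1]`. -/
theorem exists_sparse_mean {ι : Type u} [Fintype ι] (v : ι → ℝ) {K : ℕ} (hK : K ≠ 0) :
    ∃ (α : Type u) (_ : Fintype α) (W : α → ℝ) (w : α → ι → ℝ),
      (∀ f, 0 ≤ W f) ∧ ∑ f, W f = 1 ∧
      (∀ f, ∃ S : Finset ι, S.card ≤ K ∧ ∀ i, i ∉ S → w f i = 0) ∧
      (∀ i, ∑ f, W f * w f i = v i) ∧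
      ∀ r : ι → ℝ, (∀ i, |r i| ≤ 1) →
        ∑ f, W f * |∑ i, r i * (w f i - v i)| ≤ (∑ i, |v i|) / Real.sqrt K := by
  classical
  have hK' : (0 : ℝ) < K := by positivity
  have hs := Real.sqrt_pos.2 hK'
  rcases (Finset.sum_nonneg fun i (_ : i ∈ Finset.univ) => abs_nonneg (v i)).eq_or_lt with h0 | hL
  · have hv : ∀ i, v i = 0 := fun i => abs_eq_zero.1
      ((Finset.sum_eq_zero_iff_of_nonneg fun i _ => abs_nonneg (v i)).1 h0.symm i
        (Finset.mem_univ i))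
    refine ⟨PUnit, inferInstance, fun _ => 1, fun _ _ => 0, fun _ => zero_le_one, by simp,
      fun _ => ⟨∅, by simp, fun _ _ => rfl⟩, fun i => by simp [hv i], fun r _ => by simp [hv]⟩
  set L := ∑ i, |v i|
  have hp0 : ∀ i, 0 ≤ |v i| / L := fun i => by positivity
  have hp : ∑ i, |v i| / L = 1 := by rw [← Finset.sum_div, div_self hL.ne']
  have hsign : ∀ i, |v i| * SignType.sign (v i) = v i := fun i => abs_mul_sign (v i)
  -- The mean of `K` independent samples, each equal to `L · sign (v i)` times the `i`-th unit
  -- vector with probability `|v i| / L`.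
  set w : (Fin K → ι) → ι → ℝ := fun f i =>
    L / K * ∑ j, (if f j = i then ((SignType.sign (v (f j)) : SignType) : ℝ) else 0) with hw
  have hrep : ∀ (r : ι → ℝ) (f : Fin K → ι), ∑ i, r i * (w f i - v i) =
      L / K * ∑ j, (((SignType.sign (v (f j)) : SignType) : ℝ) * r (f j) -
        (∑ i, r i * v i) / L) := by
    intro r f
    simp only [mul_sub, Finset.sum_sub_distrib, hw]
    congr 1
    · simp only [Finset.mul_sum]
      rw [Finset.sum_comm]
      refine Finset.sum_congr rfl fun j _ => ?_
      simp only [mul_ite, mul_zero, Finset.sum_ite_eq, Finset.mem_univ, if_true]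
      ring
    · simp only [Finset.sum_const, Finset.card_univ, Fintype.card_fin, nsmul_eq_mul]
      field_simp
  have hmean : ∀ r : ι → ℝ, ∑ i, |v i| / L *
      (((SignType.sign (v i) : SignType) : ℝ) * r i - (∑ i, r i * v i) / L) = 0 := by
    intro r
    simp only [mul_sub, Finset.sum_sub_distrib, ← Finset.sum_mul, hp, one_mul]
    rw [sub_eq_zero, Finset.sum_div]
    refine Finset.sum_congr rfl fun i _ => ?_
    nth_rewrite 3 [← hsign i]
    ring
  -- A variance is at most the second moment, here at most 1 because `|r i| ≤ 1`.
  have hmom : ∀ r : ι → ℝ, (∀ i, |r i| ≤ 1) → ∑ i, |v i| / L *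
      (((SignType.sign (v i) : SignType) : ℝ) * r i - (∑ i, r i * v i) / L) ^ 2 ≤ 1 := by
    intro r hr
    set c := (∑ i, r i * v i) / L with hc
    have h1 : ∑ i, |v i| / L * (((SignType.sign (v i) : SignType) : ℝ) * r i) = c := by
      have := hmean r
      simp only [mul_sub, Finset.sum_sub_distrib, ← Finset.sum_mul, hp, one_mul] at this
      exact sub_eq_zero.1 this
    have h2 : ∀ i, (((SignType.sign (v i) : SignType) : ℝ) * r i) ^ 2 ≤ 1 := by
      intro i
      rw [sq_le_one_iff_abs_le_one, abs_mul]
      refine mul_le_one₀ ?_ (abs_nonneg _) (hr i)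
      rcases lt_trichotomy (v i) 0 with h | h | h <;> simp [h]
    calc _ = ∑ i, (|v i| / L * (((SignType.sign (v i) : SignType) : ℝ) * r i) ^ 2 -
            |v i| / L * (((SignType.sign (v i) : SignType) : ℝ) * r i) * (2 * c) +
            |v i| / L * c ^ 2) := Finset.sum_congr rfl fun i _ => by ring
      _ = ∑ i, |v i| / L * (((SignType.sign (v i) : SignType) : ℝ) * r i) ^ 2 - c ^ 2 := by
          rw [Finset.sum_add_distrib, Finset.sum_sub_distrib, ← Finset.sum_mul, ← Finset.sum_mul,
            h1, hp]
          ring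
      _ ≤ ∑ i, |v i| / L * 1 - 0 := by
          refine sub_le_sub (Finset.sum_le_sum fun i _ => ?_) (sq_nonneg c)
          exact mul_le_mul_of_nonneg_left (h2 i) (hp0 i)
      _ = 1 := by simp [hp]
  refine ⟨Fin K → ι, inferInstance, fun f => ∏ j, |v (f j)| / L, w,
    fun f => Finset.prod_nonneg fun j _ => hp0 _, sum_prod_weights hp K, fun f => ?_, fun i => ?_,
    fun r hr => ?_⟩
  · refine ⟨Finset.univ.image f, Finset.card_image_le.trans (by simp), fun i hi => ?_⟩
    rw [hw]
    refine mul_eq_zero_of_right _ (Finset.sum_eq_zero fun j _ => if_neg fun h => hi ?_)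
    exact Finset.mem_image.2 ⟨j, Finset.mem_univ j, h⟩
  · have h1 : ∀ f : Fin K → ι, w f i - v i = ∑ l, (Pi.single i (1 : ℝ) : ι → ℝ) l *
        (w f l - v l) := by
      intro f; simp [Pi.single_apply]
    have h2 : ∑ f : Fin K → ι, (∏ j, |v (f j)| / L) * (w f i - v i) = 0 := by
      simp only [h1, hrep]
      have := sum_prod_mul_sum hp (hmean (Pi.single i 1)) K
      calc _ = L / K * _ := by
            rw [Finset.mul_sum]
            exact Finset.sum_congr rfl fun f _ => by rw [mul_left_comm]
        _ = 0 := by rw [this, mul_zero]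
    simp only [mul_sub, Finset.sum_sub_distrib, ← Finset.sum_mul, sum_prod_weights hp K,
      one_mul] at h2
    exact sub_eq_zero.1 h2
  · have h1 := sum_prod_mul_abs_sum_le hp0 hp (hmean r) (hmom r hr) hK
    simp only [hrep, abs_mul, abs_of_pos (div_pos hL hK')]
    calc _ = L / K * _ := by
          rw [Finset.mul_sum]
          exact Finset.sum_congr rfl fun f _ => by rw [mul_left_comm]
      _ ≤ L / K * Real.sqrt K := by gcongr
      _ = _ := by
          have := Real.mul_self_sqrt hK'.le
          field_simp
          linarith

/-! ### Stable recovery from a lower isometry bound -/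

section Recovery

variable {ι : Type u} [Fintype ι] {n : ℕ} {B : Matrix (Fin n) ι ℝ} {k K : ℕ} {c : ℝ}

theorem l2Norm_sum_le {α : Type*} [Fintype α] {W : α → ℝ} (hW : ∀ f, 0 ≤ W f) (w : α → ι → ℝ) :
    l2Norm (∑ f, W f • w f) ≤ ∑ f, W f * l2Norm (w f) := by
  simp only [l2Norm, WithLp.toLp_sum, WithLp.toLp_smul]
  refine (norm_sum_le _ _).trans (le_of_eq (Finset.sum_congr rfl fun f _ => ?_))
  rw [norm_smul, Real.norm_of_nonneg (hW f)]

/-- A lower bound on sparse vectors extends to all vectors, up to the `ℓ1` norm off a small set. -/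
theorem mul_l2Norm_le_meanAbs_add (hB : ∀ i p, |B i p| ≤ 1) (hc : 0 ≤ c) (hK : K ≠ 0)
    (hlow : ∀ x : ι → ℝ, IsSparse (k + K) x → c * l2Norm x ≤ meanAbs B x)
    [DecidableEq ι] (S : Finset ι) (hS : S.card ≤ k) (h : ι → ℝ) :
    c * l2Norm h ≤ meanAbs B h + (∑ i ∈ Sᶜ, |h i|) / Real.sqrt K := by
  set v : ι → ℝ := fun i => if i ∈ S then 0 else h i with hv
  have hvL : ∑ i, |v i| = ∑ i ∈ Sᶜ, |h i| := by
    rw [← Finset.sum_add_sum_compl S, Finset.sum_eq_zero fun i hi => by simp [hv, hi], zero_add]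
    exact Finset.sum_congr rfl fun i hi => by simp [hv, Finset.mem_compl.1 hi]
  obtain ⟨α, _, W, w, hW0, hW1, hsupp, hmean, hdev⟩ := exists_sparse_mean v hK
  rw [hvL] at hdev
  -- Only the part of `h` off `S` is sampled: each `x f` is `(k + K)`-sparse, and their mean is `h`.
  set x : α → ι → ℝ := fun f => (h - v) + w f with hx
  have hsum : ∑ f, W f • x f = h := by
    funext i
    simp only [hx, Finset.sum_apply, Pi.smul_apply, Pi.add_apply, Pi.sub_apply, smul_eq_mul,
      mul_add, Finset.sum_add_distrib, hmean, ← Finset.sum_mul, hW1]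
    ring
  have hxs : ∀ f, IsSparse (k + K) (x f) := by
    intro f
    obtain ⟨T, hT, hTw⟩ := hsupp f
    refine isSparse_of_support (S ∪ T) ((Finset.card_union_le _ _).trans (by omega)) fun i hi => ?_
    rw [Finset.mem_union, not_or] at hi
    simp [hx, hv, hi.1, hTw i hi.2]
  have hxm : ∀ f, meanAbs B (x f) ≤
      meanAbs B h + 1 / (n : ℝ) * ∑ i, |∑ p, B i p * (w f p - v p)| := by
    intro f
    have : x f = h + (w f - v) := by change h - v + w f = _; abel
    rw [this]
    refine (meanAbs_add_le B _ _).trans (le_of_eq ?_)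
    rw [meanAbs, meanAbs, l1Norm_eq (B.mulVec (w f - v))]
    rfl
  calc c * l2Norm h ≤ c * ∑ f, W f * l2Norm (x f) := by
        gcongr
        nth_rewrite 1 [← hsum]
        exact l2Norm_sum_le hW0 x
    _ = ∑ f, W f * (c * l2Norm (x f)) := by
        rw [Finset.mul_sum]; exact Finset.sum_congr rfl fun f _ => by ring
    _ ≤ ∑ f, W f * (meanAbs B h + 1 / (n : ℝ) * ∑ i, |∑ p, B i p * (w f p - v p)|) :=
        Finset.sum_le_sum fun f _ =>
          mul_le_mul_of_nonneg_left ((hlow _ (hxs f)).trans (hxm f)) (hW0 f)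
    _ = meanAbs B h + 1 / (n : ℝ) * ∑ i, ∑ f, W f * |∑ p, B i p * (w f p - v p)| := by
        simp only [mul_add, Finset.sum_add_distrib, ← Finset.sum_mul, hW1, one_mul]
        rw [Finset.sum_comm, Finset.mul_sum]
        congr 1
        refine Finset.sum_congr rfl fun f _ => ?_
        rw [← Finset.mul_sum]; ring
    -- Each row of `B` is an admissible functional for Maurey's bound, since its entries are at most
    -- 1 in modulus.
    _ ≤ meanAbs B h + 1 / (n : ℝ) * ∑ _i : Fin n, (∑ i ∈ Sᶜ, |h i|) / Real.sqrt K := by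
        gcongr with i
        exact hdev (B i) (hB i)
    _ ≤ _ := by
        rw [Finset.sum_const, Finset.card_univ, Fintype.card_fin, nsmul_eq_mul, ← mul_assoc]
        gcongr
        refine mul_le_of_le_one_left (by positivity) ?_
        rw [one_div]
        exact inv_mul_le_one

/-- The cone condition: mass gained by `z` off `S` must be paid for by mass lost on `S`, up to the
tail of `a`. -/
theorem sum_compl_abs_sub_le [DecidableEq ι] (S : Finset ι) {a z : ι → ℝ}
    (h : l1Norm z ≤ l1Norm a) :
    ∑ i ∈ Sᶜ, |(z - a) i| ≤ ∑ i ∈ S, |(z - a) i| + 2 * ∑ i ∈ Sᶜ, |a i| := by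
  rw [l1Norm_eq, l1Norm_eq, ← Finset.sum_add_sum_compl S, ← Finset.sum_add_sum_compl S] at h
  have h1 : ∑ i ∈ S, |a i| ≤ ∑ i ∈ S, |z i| + ∑ i ∈ S, |(z - a) i| := by
    rw [← Finset.sum_add_distrib]
    refine Finset.sum_le_sum fun i _ => ?_
    have := abs_sub_abs_le_abs_sub (a i) (z i)
    rw [abs_sub_comm] at this
    simp only [Pi.sub_apply]; linarith
  have h2 : ∑ i ∈ Sᶜ, |(z - a) i| ≤ ∑ i ∈ Sᶜ, |z i| + ∑ i ∈ Sᶜ, |a i| := by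
    rw [← Finset.sum_add_distrib]
    exact Finset.sum_le_sum fun i _ => abs_sub (z i) (a i)
  linarith

/-- Stable recovery by `ℓ1` minimisation from a lower isometry bound. -/
theorem l2Norm_sub_le_of_isSolutionP2 (hB : ∀ i p, |B i p| ≤ 1) (hc : 0 ≤ c) (hK : K ≠ 0)
    (hlow : ∀ x : ι → ℝ, IsSparse (k + K) x → c * l2Norm x ≤ meanAbs B x) {b : ℝ} (hb : 0 < b)
    (hbc : b ≤ c - Real.sqrt ((k : ℝ) / K)) {a ak z : ι → ℝ} {η : Fin n → ℝ} {ν : ℝ}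
    (hη : l1Norm η ≤ ν) (hak : IsSparse k ak) (hz : IsSolutionP2 B (B.mulVec a + η) ν z) :
    l2Norm (z - a) ≤ 2 / b * (l1Norm (a - ak) / Real.sqrt K) + 2 / b * (ν / n) := by
  classical
  obtain ⟨S, hS, hSa⟩ := exists_support_of_isSparse hak
  have hK' : (0 : ℝ) < K := by positivity
  have hs := Real.sqrt_pos.2 hK'
  have hza : l1Norm z ≤ l1Norm a := hz.2 a (by rwa [add_sub_cancel_left])
  have h1 := sum_compl_abs_sub_le S hza
  have h2 : ∑ i ∈ Sᶜ, |a i| ≤ l1Norm (a - ak) := by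
    rw [l1Norm_eq]
    refine le_trans (le_of_eq ?_) (Finset.sum_le_sum_of_subset_of_nonneg (Finset.subset_univ Sᶜ)
      fun i _ _ => abs_nonneg _)
    exact Finset.sum_congr rfl fun i hi => by simp [hSa i (Finset.mem_compl.1 hi)]
  have h3 : ∑ i ∈ S, |(z - a) i| ≤ Real.sqrt k * l2Norm (z - a) := by
    refine (sum_abs_le_sqrt_mul_l2Norm S _).trans ?_
    gcongr
    exact l2Norm_nonneg _
  -- Both `z` and `a` are feasible, so their images lie within `2ν` of each other.
  have h4 : meanAbs B (z - a) ≤ 2 * (ν / n) := by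
    have e : B.mulVec (z - a) = (-1 : ℝ) • (B.mulVec a + η - B.mulVec z) + η := by
      rw [Matrix.mulVec_sub, neg_one_smul]; abel
    have := l1Norm_add_le ((-1 : ℝ) • (B.mulVec a + η - B.mulVec z)) η
    rw [← e, l1Norm_smul, abs_neg, abs_one, one_mul] at this
    rw [meanAbs]
    calc _ ≤ 1 / (n : ℝ) * (ν + ν) := by
          gcongr
          exact this.trans (add_le_add hz.1 hη)
      _ = _ := by ring
  have h5 := mul_l2Norm_le_meanAbs_add hB hc hK hlow S hS (z - a)
  have h6 : (∑ i ∈ Sᶜ, |(z - a) i|) / Real.sqrt K ≤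
      Real.sqrt ((k : ℝ) / K) * l2Norm (z - a) + 2 * (l1Norm (a - ak) / Real.sqrt K) := by
    rw [Real.sqrt_div (Nat.cast_nonneg _), div_mul_eq_mul_div, ← mul_div_assoc, ← add_div]
    gcongr
    linarith
  have h7 := mul_le_mul_of_nonneg_right hbc (l2Norm_nonneg (z - a))
  have h8 : l2Norm (z - a) ≤ (2 * (l1Norm (a - ak) / Real.sqrt K) + 2 * (ν / n)) / b := by
    rw [le_div_iff₀ hb]; linarith
  exact h8.trans (le_of_eq (by ring))

end Recovery

/-! ### From counting sign patterns to probabilities -/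

theorem measureReal_eq_sgn {Ω : Type*} [MeasurableSpace Ω] {P : Measure Ω}
    {n d : ℕ} {β : Fin n → Fin d → Ω → ℝ} (h : IsRademacherMatrix P β) (s : Fin n → Fin d → Bool) :
    P.real (⋂ q ∈ (Finset.univ : Finset (Fin n × Fin d)), β q.1 q.2 ⁻¹' {sgn (s q.1 q.2)}) =
      (Fintype.card (Fin n → Fin d → Bool) : ℝ)⁻¹ := by
  rw [measureReal_def, h.indep.measure_inter_preimage_eq_mul Finset.univ
    fun q _ => measurableSet_singleton _, ENNReal.toReal_prod]
  have : ∀ q : Fin n × Fin d, (P (β q.1 q.2 ⁻¹' {sgn (s q.1 q.2)})).toReal = 1 / 2 := by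
    intro q
    cases s q.1 q.2
    · exact h.prob_neg_one q.1 q.2
    · exact h.prob_one q.1 q.2
  simp only [this]
  simp [pow_mul']

/-- Probabilities of events about a Rademacher matrix are at least the proportions of good sign
patterns. -/
theorem one_sub_le_measureReal {Ω : Type*} [MeasurableSpace Ω] {P : Measure Ω}
    [IsProbabilityMeasure P] {n d : ℕ} {β : Fin n → Fin d → Ω → ℝ} (h : IsRademacherMatrix P β)
    {Q : (Fin n → Fin d → ℝ) → Prop} {δ : ℝ}
    (hQ : ∀ bad : Finset (Fin n → Fin d → Bool), (∀ s ∈ bad, ¬ Q fun i j => sgn (s i j)) →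
      (bad.card : ℝ) ≤ Fintype.card (Fin n → Fin d → Bool) * δ) :
    1 - δ ≤ P.real {ω | Q fun i j => β i j ω} := by
  classical
  set good := Finset.univ.filter fun s : Fin n → Fin d → Bool => Q fun i j => sgn (s i j) with hg
  set bad := Finset.univ.filter fun s : Fin n → Fin d → Bool => ¬ Q fun i j => sgn (s i j) with hb
  set E : (Fin n → Fin d → Bool) → Set Ω := fun s =>
    ⋂ q ∈ (Finset.univ : Finset (Fin n × Fin d)), β q.1 q.2 ⁻¹' {sgn (s q.1 q.2)} with hE
  have mem : ∀ s ω, ω ∈ E s ↔ ∀ i j, β i j ω = sgn (s i j) := by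
    intro s ω
    simp [hE]
  have hmeas : ∀ s, MeasurableSet (E s) := fun s =>
    Finset.measurableSet_biInter _ fun q _ => h.measurable q.1 q.2 (measurableSet_singleton _)
  have hdisj : (good : Set (Fin n → Fin d → Bool)).PairwiseDisjoint E := by
    intro s _ t _ hst
    refine Set.disjoint_left.2 fun ω hs ht => hst ?_
    rw [mem] at hs ht
    funext i j
    have := (hs i j).symm.trans (ht i j)
    revert this
    cases s i j <;> cases t i j <;> norm_num [sgn]
  have hcard : (good.card : ℝ) + bad.card = Fintype.card (Fin n → Fin d → Bool) := by
    exact_mod_cast Finset.card_filter_add_card_filter_not (s := Finset.univ) _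
  have hpos : (0 : ℝ) < Fintype.card (Fin n → Fin d → Bool) := by
    exact_mod_cast Fintype.card_pos
  have hbad := hQ bad fun s hs => (Finset.mem_filter.1 hs).2
  calc 1 - δ ≤ good.card * (Fintype.card (Fin n → Fin d → Bool) : ℝ)⁻¹ := by
        rw [← div_eq_mul_inv, le_div_iff₀ hpos]; linarith
    _ = P.real (⋃ s ∈ good, E s) := by
        rw [measureReal_biUnion_finset hdisj fun s _ => hmeas s,
          Finset.sum_congr rfl fun s _ => measureReal_eq_sgn h s]
        simp
    _ ≤ _ := by
        -- The event itself may fail to be measurable; it contains a finite disjoint union of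
        -- measurable cylinders, and monotonicity suffices.
        refine measureReal_mono (Set.iUnion₂_subset fun s hs ω hω => ?_)
        rw [mem] at hω
        simpa only [Set.mem_ofPred_eq, hω] using (Finset.mem_filter.1 hs).2

theorem abs_bilinMatrix_le {n d : ℕ} {s : Fin n → Fin d → ℝ} (hs : ∀ i j, s i j = 1 ∨ s i j = -1)
    (i : Fin n) (p : Pairs d) : |bilinMatrix s i p| ≤ 1 := by
  rw [bilinMatrix, Matrix.of_apply]
  rcases hs i p.1.1 with h | h <;> rcases hs i p.1.2 with h' | h' <;> simp [h, h']

theorem sgn_eq (b : Bool) : sgn b = 1 ∨ sgn b = -1 := by cases b <;> simp [sgn]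

/-- Caps the order at the dimension, so that the isometry property stays applicable when `k + K`
exceeds `d.choose 2`. -/
theorem IsSparse.min_choose {d k : ℕ} {x : Pairs d → ℝ} (hx : IsSparse k x) :
    IsSparse (min k (d.choose 2)) x := by
  refine le_min hx ?_
  rw [← card_pairs, ← Nat.card_eq_fintype_card]
  exact Set.ncard_le_card _

end SparseBilinear

/-! ### The main theorem -/

open SparseBilinear in
theorem mainTheorem7 :
    (∃ c₁ c₂ c₃ : ℝ, 0 < c₁ ∧ 0 < c₂ ∧ 0 < c₃ ∧
      -- concentration for a fixed vector
      (∀ (d n : ℕ) (Ω : Type u) [MeasurableSpace Ω] (P : Measure Ω) [IsProbabilityMeasure P]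
        (β : Fin n → Fin d → Ω → ℝ), IsRademacherMatrix P β →
        ∀ a : Pairs d → ℝ,
          1 - Real.exp (-(c₃ * n)) ≤ P.real {ω |
            c₁ * l2Norm a ≤
              1 / (n : ℝ) * l1Norm ((bilinMatrix fun i j => β i j ω).mulVec a) ∧
            1 / (n : ℝ) * l1Norm ((bilinMatrix fun i j => β i j ω).mulVec a) ≤
              c₂ * l2Norm a}) ∧
      -- restricted isometry property, with the same constants `c₁`, `c₂`
      (∃ c₁' c₂' c₃' : ℝ, 0 < c₁' ∧ 0 < c₂' ∧ 0 < c₃' ∧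
        ∀ d n k : ℕ, 1 ≤ k → k ≤ d.choose 2 →
          c₃' * (k * Real.log ((d : ℝ) ^ 2 / k)) < n →
          ∃ γlb γub : ℝ, c₁ / 2 ≤ 1 - γlb ∧ 1 + γub ≤ 2 * c₂ ∧
            ∀ (Ω : Type u) [MeasurableSpace Ω] (P : Measure Ω) [IsProbabilityMeasure P]
              (β : Fin n → Fin d → Ω → ℝ), IsRademacherMatrix P β →
              1 - c₁' * Real.exp (-(c₂' * n)) ≤ P.real {ω |
                SatisfiesRIP (bilinMatrix fun i j => β i j ω) k γlb γub})) ∧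
    -- recovery for every realization that satisfies the RIP condition
    (∃ C₁ C₂ C₃ : ℝ, 0 < C₁ ∧ 0 < C₂ ∧ 0 < C₃ ∧
      ∀ (d n k K : ℕ) (s : Fin n → Fin d → ℝ), (∀ i j, s i j = 1 ∨ s i j = -1) →
        2 * k < K →
        ∀ γlb γub γlb' γub' b : ℝ,
          SatisfiesRIP (bilinMatrix s) (k + K) γlb γub' →
          SatisfiesRIP (bilinMatrix s) K γlb' γub →
          0 < b →
          b ≤ (1 - γlb) / Real.sqrt 2 - (1 + γub) * Real.sqrt ((k : ℝ) / K) →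
          ∀ (a ak ahat : Pairs d → ℝ) (η : Fin n → ℝ) (ν : ℝ),
            l1Norm η ≤ ν →
            IsBestTermApprox k a ak →
            IsSolutionP2 (bilinMatrix s) ((bilinMatrix s).mulVec a + η) ν ahat →
            l2Norm (ahat - a) ≤
              (C₁ / b + C₃) * (l1Norm (a - ak) / Real.sqrt K) + C₂ / b * (ν / n)) ∧
    -- uniform recovery with high probability
    (∃ c₃ c₄ C₃ C₄ : ℝ, 0 < c₃ ∧ 0 < c₄ ∧ 0 < C₃ ∧ 0 < C₄ ∧
      ∀ d n k : ℕ, 1 ≤ k → k ≤ d.choose 2 →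
        c₃ * (k * Real.log ((d : ℝ) ^ 2 / k)) ≤ n →
        ∀ (Ω : Type u) [MeasurableSpace Ω] (P : Measure Ω) [IsProbabilityMeasure P]
          (β : Fin n → Fin d → Ω → ℝ), IsRademacherMatrix P β →
          1 - Real.exp (-(c₄ * n)) ≤ P.real {ω |
            ∀ (a ak ahat : Pairs d → ℝ) (η : Fin n → ℝ) (ν : ℝ),
              l1Norm η ≤ ν →
              IsBestTermApprox k a ak →
              IsSolutionP2 (bilinMatrix fun i j => β i j ω)
                ((bilinMatrix fun i j => β i j ω).mulVec a + η) ν ahat →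
              l2Norm (ahat - a) ≤
                C₃ * (l1Norm (a - ak) / Real.sqrt k) + C₄ * (ν / n)}) := by
  classical
  obtain ⟨C, hC, hrip⟩ := exists_card_not_rip_le
  refine ⟨⟨1 / 96, 60000, 1 / 4000, by norm_num, by norm_num, by norm_num, ?_,
    1, 1 / 8000, C, one_pos, by norm_num, hC, ?_⟩,
    ⟨2, 2, 1, two_pos, two_pos, one_pos, ?_⟩,
    -- With `K = 384² k = 147456 k`, the root `√(k/K) = 1/384` is half of the isometry constant
    -- `1/192`. So `b = 1/384`, giving `2/b = 768` and `2 / (b √K) = 2 / √k`.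
    ⟨C * 147457, 1 / 8000, 2, 768, by positivity, by norm_num, by norm_num, by norm_num, ?_⟩⟩
  · intro d n Ω _ P _ β hβ a
    refine one_sub_le_measureReal (Q := fun M =>
      1 / 96 * l2Norm a ≤ 1 / (n : ℝ) * l1Norm ((bilinMatrix M).mulVec a) ∧
      1 / (n : ℝ) * l1Norm ((bilinMatrix M).mulVec a) ≤ 60000 * l2Norm a) hβ fun bad hbad => ?_
    refine le_trans ?_ (card_not_concentrated_signMatrix d n a)
    exact_mod_cast Finset.card_le_card fun s hs =>
      Finset.mem_filter.2 ⟨Finset.mem_univ _, hbad s hs⟩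
  · intro d n k hk hkd hn
    refine ⟨1 - 1 / 192, 119999, by norm_num, by norm_num, fun Ω _ P _ β hβ => ?_⟩
    rw [one_mul]
    refine one_sub_le_measureReal (Q := fun M => SatisfiesRIP (bilinMatrix M) k (1 - 1 / 192)
      119999) hβ fun bad hbad => hrip d n k hk hkd hn.le bad fun s hs hx => hbad s hs ?_
    refine ⟨by norm_num, by norm_num, by norm_num, fun x hxs => ?_⟩
    have := hx x hxs
    rw [show (1 : ℝ) - (1 - 1 / 192) = 1 / 192 by norm_num,
      show (1 : ℝ) + 119999 = 120000 by norm_num]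
    exact this
  · intro d n k K s hs hkK γlb γub γlb' γub' b h1 h2 hb hbc a ak z η ν hη hak hz
    have hγ : 0 ≤ 1 - γlb := by linarith [h1.2.1]
    have hσ : 0 ≤ l1Norm (a - ak) / Real.sqrt K := div_nonneg (l1Norm_nonneg _) (Real.sqrt_nonneg _)
    -- The stated gap condition is stronger than `b ≤ (1 - γlb) - √(k/K)`, as `√2 ≥ 1` and `γub >
    -- 0`.
    have h3 : (1 - γlb) / Real.sqrt 2 ≤ 1 - γlb :=
      div_le_self hγ (Real.one_le_sqrt.2 one_le_two)
    have h4 := mul_nonneg h2.2.2.1.le (Real.sqrt_nonneg ((k : ℝ) / K))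
    have := l2Norm_sub_le_of_isSolutionP2 (abs_bilinMatrix_le hs) hγ (by omega : K ≠ 0)
      (fun x hx => (h1.2.2.2 x hx).1) hb (by linarith) hη hak.1 hz
    linarith
  · intro d n k hk hkd hn Ω _ P _ β hβ
    refine one_sub_le_measureReal (Q := fun M =>
      ∀ (a ak ahat : Pairs d → ℝ) (η : Fin n → ℝ) (ν : ℝ), l1Norm η ≤ ν →
        IsBestTermApprox k a ak →
        IsSolutionP2 (bilinMatrix M) ((bilinMatrix M).mulVec a + η) ν ahat →
        l2Norm (ahat - a) ≤ 2 * (l1Norm (a - ak) / Real.sqrt k) + 768 * (ν / n)) hβ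
      fun bad hbad => ?_
    have hk' : (0 : ℝ) < k := by exact_mod_cast hk
    set k' := min (k + 147456 * k) (d.choose 2)
    have hkk' : k ≤ k' := le_min (by omega) hkd
    have hk'le : (k' : ℝ) ≤ 147457 * k := by
      have : k' ≤ k + 147456 * k := min_le_left _ _
      exact_mod_cast (show k' ≤ 147457 * k by omega)
    have hd : (0 : ℝ) < (d : ℝ) ^ 2 := by
      have : (k : ℝ) ≤ d.choose 2 := by exact_mod_cast hkd
      linarith [two_mul_choose_two_le d]
    have hkk'' : (k : ℝ) ≤ k' := by exact_mod_cast hkk'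
    have hk'0 : (0 : ℝ) < k' := hk'.trans_le hkk''
    -- Raising the order to `k'` lowers the logarithm, so the sample size need only grow by the
    -- factor `147457`.
    have hlog : Real.log ((d : ℝ) ^ 2 / k') ≤ Real.log ((d : ℝ) ^ 2 / k) := by
      apply Real.log_le_log (by positivity)
      gcongr
    have hl := half_le_log_sq_div hk hkd
    refine hrip d n k' (hk.trans hkk') (min_le_right _ _) (le_trans ?_ hn) bad
      fun s hs hx => hbad s hs fun a ak z η ν hη hak hz => ?_
    · rw [mul_assoc C]
      refine mul_le_mul_of_nonneg_left ?_ hC.le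
      rw [← mul_assoc]
      have : 0 ≤ Real.log ((d : ℝ) ^ 2 / k) := by linarith
      exact (mul_le_mul_of_nonneg_left hlog hk'0.le).trans (mul_le_mul_of_nonneg_right hk'le this)
    · have hsq : Real.sqrt 147456 = 384 := by
        rw [show (147456 : ℝ) = 384 ^ 2 by norm_num, Real.sqrt_sq (by norm_num)]
      have := l2Norm_sub_le_of_isSolutionP2 (c := 1 / 192) (b := 1 / 384) (k := k)
        (K := 147456 * k) (abs_bilinMatrix_le fun i j => sgn_eq (s i j)) (by norm_num) (by omega)
        (fun x hx' => (hx x hx'.min_choose).1) (by norm_num) (by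
          push_cast
          rw [show (k : ℝ) / (147456 * k) = 1 / 147456 by field_simp,
            Real.sqrt_div zero_le_one, hsq, Real.sqrt_one]
          norm_num) hη hak.1 hz
      refine this.trans (le_of_eq ?_)
      push_cast
      rw [Real.sqrt_mul (by norm_num), hsq]
      field_simp
      ring
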